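/- Let $p\ge q$, let $X=\mathbf{R}^{p\times q}$ with the Frobenius inner product, let $\sigma_1(\cdot)\ge\sigma_2(\cdot)\ge\dots$ denote singular values, $\Sigma_k(z)=\sum_{i\le k}\sigma_i(z)$ (singular values beyond the last one are $0$), $\|\cdot\|$ the nuclear norm (the sum of all singular values) and $\|\cdot\|_{2,2}=\sigma_1(\cdot)$ the spectral norm. Let $A:X\to\mathbf{R}^m$ be linear, $\phi$ a norm on $\mathbf{R}^m$ and $s\ge 0$ an integer. For $h,w\in X$ let $h^T\otimes w$ be the $pq\times pq$ matrix with $p\times q$ blocks $[h^T\otimes w]^{\mu\nu}=h_{\nu\mu}w$, $1\le\mu\le q$, $1\le\nu\le p$. Let $\mathcal M':\mathbf{R}^{pq\times pq}\to\mathbf{R}^{p^2\times q^2}$ and $\mathcal M'':\mathbf{R}^{pq\times pq}\to\mathbf{R}^{pq\times pq}$ be the rearrangements of entries with $\mathcal M'(h^T\otimes w)=h\otimes w$ and $\mathcal M''(h^T\otimes w)=f(h)g(w)^T$, where $f(h)$ stacks the rows of $h$ and $g(w)$ stacks the columns of $w$. For an integer $k\ge0$ put $$\mathbf Z_k=\{h^T\otimes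 w:\ \|h\|\le k,\ \|h\|_{2,2}\le1,\ \|w\|\le1\},\qquad \mathbf U_k=\{\mathcal U\in\mathbf{R}^{pq\times pq}:\ \|\mathcal U\|\le k,\ \|\mathcal U\|_{2,2}\le 1\},$$ $$\mathbf Z^*_k=\{\mathcal U\in\mathbf{R}^{pq\times pq}:\ \|\mathcal U\|\le k,\ \|\mathcal U\|_{2,2}\le1,\ \|\mathcal M'(\mathcal U)\|\le k,\ \|\mathcal M'(\mathcal U)\|_{2,2}\le1,\ \|\mathcal M''(\mathcal U)\|\le\sqrt k\}.$$ For a linear map $W:X\to X$ let $\Theta[W]$ be the $pq\times pq$ matrix, linear in $W$, with $\mathrm{Tr}([Wz]h^T)=\sum_{i,j}(\Theta[W])_{ij}(h^T\otimes z)_{ij}$ for all $h,z\in X$, and let $$\mathrm{Opt}[W]=\max_{\|z\|\le1}\{\Sigma_s(Wz)+\Sigma_{2s}(Wz)\},\qquad \mathrm{Opt}^*[W]=\max\Big\{\sum_{i,j}(\Theta[W])_{ij}[\mathcal U_{ij}+\mathcal V_{ij}]:\ \mathcal U\in\mathbf Z^*_s,\ \mathcal V\in\mathbf Z^*_{2s}\Big\},$$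 and let $\overline{\mathrm{Opt}}[W]$ be the last maximum with $\mathbf U_s,\mathbf U_{2s}$ in place of $\mathbf Z^*_s,\mathbf Z^*_{2s}$. For a linear map $H:X\to\mathbf{R}^m$ with conjugate $H^*$ let $\beta[H]=\max_{\phi(v)\le1}\{\Sigma_s(H^*v)+\Sigma_{2s}(H^*v)\}$. Let $\widehat\beta$ be a real-valued convex function of $H$ with $\beta[H]\le\widehat\beta[H]$ for all $H$. Then: (i) For every integer $k\ge0$, $\mathbf Z_k\subseteq\mathbf Z^*_k\subseteq\mathbf U_k$, and $\mathbf Z^*_k$ is convex and computationally tractable in the following sense: it is the projection of the solution set of a linear matrix inequality of order at most $10(p+q+1)^4$, with at most $10(p+q+1)^4$ additional variables, whose symmetric coefficient matrices have integer entries of absolute value at most $2k+2$. (ii) All the maxima above are attained, $\mathrm{Opt}[W]\le\mathrm{Opt}^*[W]\le\overline{\mathrm{Opt}}[W]$ for all $W$, and $\mathrm{Opt}^*[W]$ is convex in $W$ and $\mathrm{Opt}^*[\mathrm{Id}-H^*A]$ is convex in $H$. (iii) For all $\gamma\in[0,\infty)$ and $\beta\in[0,\infty]$, the solution set of the system $$\mathrm{Opt}^*[\mathrm{Id}-H^*A]\le\gamma,\qquad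 \widehat\beta[H]\le\beta$$ in the variable $H$ is convex, and if the system is solvable, then $$\forall z\in\mathbf{R}^{p\times q}:\quad \Sigma_s(z)+\Sigma_{2s}(z)\le\beta\,\phi(Az)+\gamma\|z\|,$$ where $(+\infty)\cdot0=0$ and $(+\infty)\cdot a=+\infty$ for $a>0$. -/

import Mathlib

open scoped Matrix Kronecker

namespace NuclearRecovery

noncomputable section

section Norms

variable {ι κ : Type*} [Fintype ι] [Fintype κ] [DecidableEq κ]

/-- `singVal M i` is the `(i+1)`-st largest singular value of the real matrix `M`
(and `0` when there is no such singular value). -/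
def singVal (M : Matrix ι κ ℝ) (i : ℕ) : ℝ :=
  (Matrix.toEuclideanLin M).singularValues i

/-- `Σ_k(M)`, the sum of the `k` largest singular values. -/
def sigmaSum (k : ℕ) (M : Matrix ι κ ℝ) : ℝ :=
  ∑ i ∈ Finset.range k, singVal M i

/-- The nuclear norm: the sum of all singular values. -/
def nuclearNorm (M : Matrix ι κ ℝ) : ℝ :=
  sigmaSum (Fintype.card κ) M

/-- The spectral norm: the largest singular value. -/
def spectralNorm (M : Matrix ι κ ℝ) : ℝ :=
  singVal M 0

end Norms

/-- The signal space `X = ℝ^{p×q}`. -/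
abbrev Signal (p q : ℕ) := Matrix (Fin p) (Fin q) ℝ

/-- The `pq × pq` matrices, seen as `q × p` block matrices with blocks of size `p × q`:
the entry at `((μ, i), (ν, j))` is the entry `(i, j)` of the block `(μ, ν)`. -/
abbrev BigMatrix (p q : ℕ) := Matrix (Fin q × Fin p) (Fin p × Fin q) ℝ

variable {p q m : ℕ}

/-- The conjugate `H* : ℝ^m → X` of `H : X → ℝ^m`, for the Frobenius inner product on `X` and
the standard inner product on `ℝ^m`. -/
def conjMap (H : Signal p q →ₗ[ℝ] (Fin m → ℝ)) : (Fin m → ℝ) →ₗ[ℝ] Signal p q where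
  toFun v := Matrix.of fun i j => H (Matrix.single i j 1) ⬝ᵥ v
  map_add' v w := by
    ext i j
    simp [dotProduct_add]
  map_smul' c v := by
    ext i j
    simp [dotProduct_smul]

/-- Every matrix is the combination of the standard basis with its entries as coefficients,
so a linear map is determined by its values on the standard basis. -/
theorem map_eq_sum_single {F : Type*} [AddCommMonoid F] [Module ℝ F]
    (L : Signal p q →ₗ[ℝ] F) (z : Signal p q) :
    L z = ∑ i, ∑ j, z i j • L (Matrix.single i j 1) := by
  conv_lhs => rw [Matrix.matrix_eq_sum_single z]
  simp only [map_sum]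
  refine Finset.sum_congr rfl fun i _ => Finset.sum_congr rfl fun j _ => ?_
  rw [← map_smul, Matrix.smul_single, smul_eq_mul, mul_one]

/-- The identity defining the conjugate map. -/
theorem trace_conjMap (H : Signal p q →ₗ[ℝ] (Fin m → ℝ)) (v : Fin m → ℝ) (x : Signal p q) :
    (conjMap H v * xᵀ).trace = H x ⬝ᵥ v := by
  rw [map_eq_sum_single H x]
  simp [Matrix.trace, Matrix.mul_apply, conjMap, sum_dotProduct, smul_dotProduct, mul_comm]

/-- The condition `∀ z, Σ_s(z) + Σ_{2s}(z) ≤ β φ(Az) + γ ‖z‖`, where `‖·‖` is the nuclear norm and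
`β` may be infinite (in `EReal`, `⊤ * 0 = 0` and `⊤ * a = ⊤` for `a > 0`). -/
def LowRankCondition (s : ℕ) (A : Signal p q →ₗ[ℝ] (Fin m → ℝ)) (φ : Seminorm ℝ (Fin m → ℝ))
    (γ : ℝ) (β : EReal) : Prop :=
  ∀ z : Signal p q,
    ((sigmaSum s z + sigmaSum (2 * s) z : ℝ) : EReal)
      ≤ β * ((φ (A z) : ℝ) : EReal) + ((γ * nuclearNorm z : ℝ) : EReal)

/-- The values `Σ_s(H*v) + Σ_{2s}(H*v)` with `φ(v) ≤ 1`. -/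
def betaValues (s : ℕ) (φ : Seminorm ℝ (Fin m → ℝ)) (H : Signal p q →ₗ[ℝ] (Fin m → ℝ)) : Set ℝ :=
  (fun v => sigmaSum s (conjMap H v) + sigmaSum (2 * s) (conjMap H v)) '' {v | φ v ≤ 1}

/-- `β[H]`, the maximum of `Σ_s(H*v) + Σ_{2s}(H*v)` over `φ(v) ≤ 1`. -/
def beta (s : ℕ) (φ : Seminorm ℝ (Fin m → ℝ)) (H : Signal p q →ₗ[ℝ] (Fin m → ℝ)) : ℝ :=
  sSup (betaValues s φ H)

/-- The map `Id - H*A` of `X` into itself. -/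
def residual (A H : Signal p q →ₗ[ℝ] (Fin m → ℝ)) : Signal p q →ₗ[ℝ] Signal p q :=
  LinearMap.id - (conjMap H).comp A

/-- The values `Σ_s(Wz) + Σ_{2s}(Wz)` with `‖z‖ ≤ 1` in the nuclear norm. -/
def optValues (s : ℕ) (W : Signal p q →ₗ[ℝ] Signal p q) : Set ℝ :=
  (fun z => sigmaSum s (W z) + sigmaSum (2 * s) (W z)) '' {z | nuclearNorm z ≤ 1}

/-- `Opt[W]`, the maximum of `Σ_s(Wz) + Σ_{2s}(Wz)` over the nuclear norm unit ball. -/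
def opt (s : ℕ) (W : Signal p q →ₗ[ℝ] Signal p q) : ℝ :=
  sSup (optValues s W)

/-- `Θ[W]`: its block `(μ, ν)` has the entry `(W e_{kl})_{νμ}` at `(k, l)`. -/
def theta (W : Signal p q →ₗ[ℝ] Signal p q) : BigMatrix p q :=
  Matrix.of fun a b => W (Matrix.single a.2 b.2 1) b.1 a.1

/-- The pairing `∑_{ij} Θ_ij U_ij`. -/
def pairing (T U : BigMatrix p q) : ℝ := ∑ a, ∑ b, T a b * U a b

/-- The defining property of `Θ[W]`. -/
theorem pairing_theta (W : Signal p q →ₗ[ℝ] Signal p q) (h z : Signal p q) :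
    pairing (theta W) (hᵀ ⊗ₖ z) = (W z * hᵀ).trace := by
  have hW : ∀ ν μ, W z ν μ = ∑ k, ∑ l, z k l * W (Matrix.single k l 1) ν μ := by
    intro ν μ
    rw [map_eq_sum_single W z]
    simp [Matrix.sum_apply]
  simp only [pairing, theta, Fintype.sum_prod_type, Matrix.trace, Matrix.diag, Matrix.mul_apply,
    Matrix.transpose_apply, Matrix.kroneckerMap_apply, Matrix.of_apply, hW, Finset.sum_mul]
  calc
    _ = ∑ μ : Fin q, ∑ ν : Fin p, ∑ k : Fin p, ∑ l : Fin q,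
          z k l * W (Matrix.single k l 1) ν μ * h ν μ := by
        refine Finset.sum_congr rfl fun μ _ => ?_
        rw [Finset.sum_comm]
        refine Finset.sum_congr rfl fun ν _ => Finset.sum_congr rfl fun k _ =>
          Finset.sum_congr rfl fun l _ => ?_
        ring
    _ = _ := Finset.sum_comm

/-- `H_k = {h : ‖h‖ ≤ k, ‖h‖_{2,2} ≤ 1}`. -/
def setH (p q k : ℕ) : Set (Signal p q) := {h | nuclearNorm h ≤ k ∧ spectralNorm h ≤ 1}

/-- `Z_k = {hᵀ ⊗ w : h ∈ H_k, ‖w‖ ≤ 1}`. -/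
def setZ (p q k : ℕ) : Set (BigMatrix p q) :=
  {U | ∃ h ∈ setH p q k, ∃ w : Signal p q, nuclearNorm w ≤ 1 ∧ U = hᵀ ⊗ₖ w}

/-- `U_k = {U : ‖U‖ ≤ k, ‖U‖_{2,2} ≤ 1}`. -/
def setU (p q k : ℕ) : Set (BigMatrix p q) := {U | nuclearNorm U ≤ k ∧ spectralNorm U ≤ 1}

/-- The rearrangement `M'` of the entries of a `pq × pq` matrix into a `p² × q²` matrix, which
sends `hᵀ ⊗ w` to `h ⊗ w`. -/
def rearr1 : BigMatrix p q →ₗ[ℝ] Matrix (Fin p × Fin p) (Fin q × Fin q) ℝ where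
  toFun U := Matrix.of fun a b => U (b.1, a.2) (a.1, b.2)
  map_add' _ _ := rfl
  map_smul' _ _ := rfl

theorem rearr1_kronecker (h w : Signal p q) : rearr1 (hᵀ ⊗ₖ w) = h ⊗ₖ w := rfl

/-- The rearrangement `M''` of the entries of a `pq × pq` matrix into another `pq × pq` matrix,
which sends `hᵀ ⊗ w` to `f(h) g(w)ᵀ`; here `f(h)` stacks the rows of `h` and `g(w)` stacks the
columns of `w`. -/
def rearr2 : BigMatrix p q →ₗ[ℝ] Matrix (Fin p × Fin q) (Fin q × Fin p) ℝ where
  toFun U := Matrix.of fun a b => U (a.2, b.2) (a.1, b.1)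
  map_add' _ _ := rfl
  map_smul' _ _ := rfl

theorem rearr2_kronecker (h w : Signal p q) :
    rearr2 (hᵀ ⊗ₖ w) =
      Matrix.vecMulVec (fun a : Fin p × Fin q => h a.1 a.2) (fun b : Fin q × Fin p => w b.2 b.1) :=
  rfl

/-- The refined set `Z*_k`. -/
def setZstar (p q k : ℕ) : Set (BigMatrix p q) :=
  {U | nuclearNorm U ≤ k ∧ spectralNorm U ≤ 1 ∧
    nuclearNorm (rearr1 U) ≤ k ∧ spectralNorm (rearr1 U) ≤ 1 ∧
    nuclearNorm (rearr2 U) ≤ √(k : ℝ)}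

/-- The values `∑_{ij} Θ[W]_ij (U_ij + V_ij)` with `U ∈ S` and `V ∈ T`. -/
def relaxValues (S T : Set (BigMatrix p q)) (W : Signal p q →ₗ[ℝ] Signal p q) : Set ℝ :=
  {t | ∃ U ∈ S, ∃ V ∈ T, t = pairing (theta W) (U + V)}

/-- `Opt*[W]`, the maximum of `∑_{ij} Θ[W]_ij (U_ij + V_ij)` over `U ∈ Z*_s`, `V ∈ Z*_{2s}`. -/
def optStar (s : ℕ) (W : Signal p q →ₗ[ℝ] Signal p q) : ℝ :=
  sSup (relaxValues (setZstar p q s) (setZstar p q (2 * s)) W)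

/-- The cruder bound: the maximum of `∑_{ij} Θ[W]_ij (U_ij + V_ij)` over `U ∈ U_s`,
`V ∈ U_{2s}`. -/
def optBar (s : ℕ) (W : Signal p q →ₗ[ℝ] Signal p q) : ℝ :=
  sSup (relaxValues (setU p q s) (setU p q (2 * s)) W)

/-- `S` is the projection of the solution set of a linear matrix inequality
`A₀ + ∑_{ij} U_ij A_ij + ∑_l y_l B_l ⪰ 0` of order at most `N` in `U` and at most `N` additional
variables `y_l`, whose symmetric coefficient matrices have integer entries of absolute value at
most `b`. -/
def IsSemidefiniteRepresentable {ι κ : Type*} [Fintype ι] [Fintype κ]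
    (S : Set (Matrix ι κ ℝ)) (N b : ℕ) : Prop :=
  ∃ (n d : ℕ) (A₀ : Matrix (Fin n) (Fin n) ℤ) (A : ι → κ → Matrix (Fin n) (Fin n) ℤ)
    (B : Fin d → Matrix (Fin n) (Fin n) ℤ),
    n ≤ N ∧ d ≤ N ∧
    (A₀.IsSymm ∧ ∀ a c, |A₀ a c| ≤ b) ∧
    (∀ i j, (A i j).IsSymm ∧ ∀ a c, |A i j a c| ≤ b) ∧
    (∀ l, (B l).IsSymm ∧ ∀ a c, |B l a c| ≤ b) ∧
    ∀ U : Matrix ι κ ℝ, U ∈ S ↔ ∃ y : Fin d → ℝ,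
      (A₀.map (Int.cast : ℤ → ℝ) + ∑ i, ∑ j, U i j • (A i j).map (Int.cast : ℤ → ℝ)
        + ∑ l, y l • (B l).map (Int.cast : ℤ → ℝ)).PosSemidef

end

end NuclearRecovery

/-! Everything rests on duality for the Frobenius pairing. The nuclear norm is the largest pairing
with a contraction, and by Ky Fan's principle `Σ_k(M)` is the largest pairing of `M` with a
contraction of nuclear norm at most `k` (`frob_le_sigmaSum`, `exists_frob_eq_sigmaSum`). Both are
read off a singular value decomposition, and both make these functions seminorms, hence convex and
continuous.

By Ky Fan, `Σ_k(Wz)` equals `Tr((Wz)hᵀ)` for some `h` in `H_k`, that is, the pairing of `Θ[W]` with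
the element `hᵀ ⊗ z` of `Z_k`. Maximizing the same linear form over a larger set can only increase
the value, whence `Opt ≤ Opt* ≤ Optbar` once `Z_k ⊆ Z*_k ⊆ U_k`. The first inclusion holds because
nuclear and spectral norms are submultiplicative under Kronecker products, while `M''(hᵀ ⊗ w)` has
rank one and norm `‖h‖_F ‖w‖_F ≤ √k`. Being a maximum of linear forms in `W`, `Opt*` is convex.

The sufficient condition comes from `z = H*(Az) + (Id - H*A)z` and the triangle inequality for `Σ_s
+ Σ_{2s}`: the first term is bounded by `β[H] φ(Az)`, the second by `Opt[Id - H*A] ‖z‖`.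

Tractability: a spectral bound is a Schur complement condition, and `‖M‖ ≤ √a √b` holds iff `M` is
the off-diagonal block of a positive semidefinite matrix with diagonal blocks of traces at most `a`
and `b`. Such conditions are stacked block-diagonally. -/

namespace NuclearRecovery

/-! ### Singular value decomposition as a sum of rank-one matrices. -/

section SingularValueDecomposition

variable {ι κ : Type*} [Fintype ι] [Fintype κ] [DecidableEq κ]

theorem singVal_nonneg (M : Matrix ι κ ℝ) (i : ℕ) : 0 ≤ singVal M i :=
  LinearMap.singularValues_nonneg _ i

theorem singVal_antitone (M : Matrix ι κ ℝ) : Antitone (singVal M) :=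
  LinearMap.singularValues_antitone _

theorem singVal_of_card_le (M : Matrix ι κ ℝ) {i : ℕ} (hi : Fintype.card κ ≤ i) :
    singVal M i = 0 :=
  LinearMap.singularValues_of_finrank_le _ (by simpa using hi)

theorem inner_eq_dotProduct {α : Type*} [Fintype α] (x y : EuclideanSpace ℝ α) :
    inner ℝ x y = x.ofLp ⬝ᵥ y.ofLp := by
  rw [EuclideanSpace.inner_eq_star_dotProduct, dotProduct_comm]
  simp

/-- The singular value decomposition. The left vectors are orthonormal up to vanishing vectors,
which belong to vanishing singular values. -/
theorem exists_svd (M : Matrix ι κ ℝ) :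
    ∃ (u : Fin (Fintype.card κ) → ι → ℝ) (v : Fin (Fintype.card κ) → κ → ℝ),
      (∀ i j, i ≠ j → u i ⬝ᵥ u j = 0) ∧ (∀ i, u i ⬝ᵥ u i ≤ 1) ∧
      (∀ i : Fin (Fintype.card κ), singVal M i ≠ 0 → u i ⬝ᵥ u i = 1) ∧
      (∀ i j, v i ⬝ᵥ v j = if i = j then 1 else 0) ∧
      (∀ x, ∑ i, (u i ⬝ᵥ x) ^ 2 ≤ x ⬝ᵥ x) ∧ (∀ x, ∑ i, (v i ⬝ᵥ x) ^ 2 ≤ x ⬝ᵥ x) ∧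
      M = ∑ i : Fin (Fintype.card κ), singVal M i • Matrix.vecMulVec (u i) (v i) := by
  set T := Matrix.toEuclideanLin M with hTdef
  have hn : Module.finrank ℝ (EuclideanSpace ℝ κ) = Fintype.card κ := finrank_euclideanSpace
  have hT := T.isSymmetric_adjoint_comp_self
  set b := hT.eigenvectorBasis hn with hb
  set σ : Fin (Fintype.card κ) → ℝ := fun i => singVal M i with hσ
  have hTb : ∀ i j, inner ℝ (T (b i)) (T (b j)) = if i = j then σ j ^ 2 else 0 := by
    intro i j
    have h1 : (T.adjoint ∘ₗ T) (b j) = (σ j ^ 2) • b j := by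
      have := hT.apply_eigenvectorBasis hn j
      rw [this]
      simp only [hσ, singVal]
      rw [LinearMap.sq_singularValues_fin _ hn]
      rfl
    have h2 : inner ℝ (T (b i)) (T (b j)) = inner ℝ (b i) ((T.adjoint ∘ₗ T) (b j)) := by
      simp [LinearMap.adjoint_inner_right]
    rw [h2, h1, inner_smul_right, orthonormal_iff_ite.1 b.orthonormal i j]
    simp
  -- Since `0⁻¹ = 0`, the left vector vanishes where `σ i = 0`. The family has one vector per
  -- column, possibly more than the dimension of the row space, so it cannot be orthonormal in
  -- general.
  set w : Fin (Fintype.card κ) → EuclideanSpace ℝ ι := fun i => (σ i)⁻¹ • T (b i) with hw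
  have hww : ∀ i j, inner ℝ (w i) (w j) = if i = j then (σ j)⁻¹ ^ 2 * σ j ^ 2 else 0 := by
    intro i j
    simp only [hw, inner_smul_left, inner_smul_right, hTb]
    split_ifs with h
    · subst h; simp; ring
    · simp
  have hTw : ∀ i, T (b i) = σ i • w i := by
    intro i
    by_cases h : σ i = 0
    · have h0 := hTb i i
      rw [h] at h0
      simp only [if_true, ne_eq, OfNat.ofNat_ne_zero, not_false_eq_true, zero_pow] at h0
      rw [inner_self_eq_zero.1 h0, h, zero_smul]
    · simp [hw, smul_smul, h]
  refine ⟨fun i => (w i).ofLp, fun i => (b i).ofLp, ?_, ?_, ?_, ?_, ?_, ?_, ?_⟩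
  · intro i j hij
    rw [← inner_eq_dotProduct, hww, if_neg hij]
  · intro i
    rw [← inner_eq_dotProduct, hww, if_pos rfl]
    by_cases h : σ i = 0
    · simp [h]
    · rw [← mul_pow, inv_mul_cancel₀ h]; simp
  · intro i h
    rw [← inner_eq_dotProduct, hww, if_pos rfl, ← mul_pow, inv_mul_cancel₀ h]; simp
  · intro i j
    rw [← inner_eq_dotProduct]
    exact orthonormal_iff_ite.1 b.orthonormal i j
  · intro x
    -- Bessel's inequality applies to the nonvanishing left vectors; the others contribute nothing
    -- to the sum.
    have ho : Orthonormal ℝ (fun i : {i // σ i ≠ 0} => w i) := by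
      rw [orthonormal_iff_ite]
      rintro ⟨i, hi⟩ ⟨j, hj⟩
      rw [hww]
      simp only [Subtype.mk.injEq]
      split_ifs
      · rw [← mul_pow, inv_mul_cancel₀ hj]; simp
      · rfl
    have := ho.sum_inner_products_le (WithLp.toLp 2 x) (s := Finset.univ)
    rw [← real_inner_self_eq_norm_sq, inner_eq_dotProduct] at this
    refine le_trans (le_of_eq ?_) this
    simp only [inner_eq_dotProduct, Real.norm_eq_abs, sq_abs]
    rw [← Finset.sum_subtype (Finset.univ.filter fun i => σ i ≠ 0) (by simp)
      (fun i => ((w i).ofLp ⬝ᵥ x) ^ 2), Finset.sum_filter_of_ne]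
    intro i _ hi h
    simp [hw, h] at hi
  · intro x
    have := b.orthonormal.sum_inner_products_le (WithLp.toLp 2 x) (s := Finset.univ)
    rw [← real_inner_self_eq_norm_sq, inner_eq_dotProduct] at this
    simpa only [inner_eq_dotProduct, Real.norm_eq_abs, sq_abs] using this
  · ext a c
    have h1 : M a c = (T (EuclideanSpace.single c 1)).ofLp a := by
      simp [hTdef, Matrix.toLpLin_apply]
    rw [h1, ← b.sum_repr (EuclideanSpace.single c 1), map_sum]
    simp only [map_smul, hTw, b.repr_apply_apply, inner_eq_dotProduct, Matrix.sum_apply,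
      Matrix.smul_apply, Matrix.vecMulVec_apply]
    simp
    refine Finset.sum_congr rfl fun i _ => ?_
    ring

end SingularValueDecomposition

/-! ### Contractions, duality of the nuclear norm, and Ky Fan's principle. -/

section Duality

variable {ι κ : Type*} [Fintype ι] [Fintype κ] 

/-- The Frobenius inner product. -/
noncomputable def frob : Matrix ι κ ℝ →ₗ[ℝ] Matrix ι κ ℝ →ₗ[ℝ] ℝ :=
  LinearMap.mk₂ ℝ (fun M N => ∑ a, ∑ b, M a b * N a b)
    (fun M M' N => by simp [add_mul, Finset.sum_add_distrib])
    (fun c M N => by simp [Finset.mul_sum, mul_assoc])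
    (fun M N N' => by simp [mul_add, Finset.sum_add_distrib])
    (fun c M N => by simp [Finset.mul_sum, mul_left_comm])

theorem frob_apply (M N : Matrix ι κ ℝ) : frob M N = ∑ a, ∑ b, M a b * N a b := rfl

theorem frob_comm (M N : Matrix ι κ ℝ) : frob M N = frob N M := by
  simp only [frob_apply, mul_comm]

theorem frob_transpose (M N : Matrix ι κ ℝ) : frob Mᵀ Nᵀ = frob M N := by
  simp only [frob_apply, Matrix.transpose_apply]
  exact Finset.sum_comm

theorem frob_eq_trace (M N : Matrix ι κ ℝ) : frob M N = (M * Nᵀ).trace := by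
  simp [frob_apply, Matrix.trace, Matrix.mul_apply]

theorem frob_vecMulVec (M : Matrix ι κ ℝ) (x : ι → ℝ) (y : κ → ℝ) :
    frob M (Matrix.vecMulVec x y) = x ⬝ᵥ M *ᵥ y := by
  simp only [frob_apply, Matrix.vecMulVec_apply, dotProduct, Matrix.mulVec, Finset.mul_sum]
  exact Finset.sum_congr rfl fun _ _ => Finset.sum_congr rfl fun _ _ => by ring

theorem dotProduct_sq_le (x y : ι → ℝ) : (x ⬝ᵥ y) ^ 2 ≤ (x ⬝ᵥ x) * (y ⬝ᵥ y) := by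
  simpa [dotProduct, sq] using Finset.sum_mul_sq_le_sq_mul_sq Finset.univ x y

theorem dotProduct_self_nonneg' (x : ι → ℝ) : 0 ≤ x ⬝ᵥ x :=
  Finset.sum_nonneg fun i _ => mul_self_nonneg (x i)

/-- Contractions for the Euclidean norms. -/
def IsContraction (N : Matrix ι κ ℝ) : Prop :=
  ∀ x : κ → ℝ, (N *ᵥ x) ⬝ᵥ (N *ᵥ x) ≤ x ⬝ᵥ x

theorem IsContraction.neg {N : Matrix ι κ ℝ} (h : IsContraction N) : IsContraction (-N) := by
  intro x
  simpa [Matrix.neg_mulVec] using h x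

/-- With `y = Nᵀx`, Cauchy–Schwarz gives `|y|⁴ = ⟨x, Ny⟩² ≤ |x|² |Ny|² ≤ |x|² |y|²`. -/
theorem IsContraction.transpose {N : Matrix ι κ ℝ} (h : IsContraction N) :
    IsContraction Nᵀ := by
  intro x
  set y := Nᵀ *ᵥ x with hy
  have h1 : y ⬝ᵥ y = x ⬝ᵥ N *ᵥ y := by
    rw [hy, Matrix.dotProduct_mulVec, ← Matrix.mulVec_transpose, dotProduct_comm,
      Matrix.transpose_transpose]
  have h2 := dotProduct_sq_le x (N *ᵥ y)
  rw [← h1] at h2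
  have h3 := h y
  have h4 := dotProduct_self_nonneg' x
  have h5 := dotProduct_self_nonneg' y
  by_contra! hlt
  nlinarith [mul_le_mul_of_nonneg_left h3 h4, mul_pos (lt_of_le_of_lt h4 hlt) (sub_pos.2 hlt)]

theorem IsContraction.mul {μ : Type*} [Fintype μ] {M : Matrix ι κ ℝ} {N : Matrix κ μ ℝ}
    (hM : IsContraction M) (hN : IsContraction N) : IsContraction (M * N) := by
  intro x
  rw [← Matrix.mulVec_mulVec]
  exact (hM _).trans (hN _)

theorem IsContraction.abs_dotProduct_mulVec_le {N : Matrix ι κ ℝ} (h : IsContraction N)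
    (x : ι → ℝ) (y : κ → ℝ) : |x ⬝ᵥ N *ᵥ y| ≤ √(x ⬝ᵥ x) * √(y ⬝ᵥ y) := by
  rw [← Real.sqrt_mul (dotProduct_self_nonneg' x)]
  refine Real.abs_le_sqrt ((dotProduct_sq_le _ _).trans ?_)
  exact mul_le_mul_of_nonneg_left (h y) (dotProduct_self_nonneg' x)

theorem IsContraction.abs_dotProduct_mulVec_le_one {N : Matrix ι κ ℝ} (h : IsContraction N)
    {x : ι → ℝ} {y : κ → ℝ} (hx : x ⬝ᵥ x ≤ 1) (hy : y ⬝ᵥ y ≤ 1) : |x ⬝ᵥ N *ᵥ y| ≤ 1 :=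
  (h.abs_dotProduct_mulVec_le x y).trans <|
    mul_le_one₀ (Real.sqrt_le_one.2 hx) (Real.sqrt_nonneg _) (Real.sqrt_le_one.2 hy)

/-- Pythagoras on the left vectors, then Bessel on the right ones. Left vectors need only length at
most 1, which accommodates the vanishing ones of `exists_svd`. -/
theorem isContraction_sum_vecMulVec {n : Type*} [Fintype n] {u : n → ι → ℝ} {v : n → κ → ℝ}
    (hu : ∀ i j, i ≠ j → u i ⬝ᵥ u j = 0) (hu1 : ∀ i, u i ⬝ᵥ u i ≤ 1)
    (hv : ∀ x, ∑ i, (v i ⬝ᵥ x) ^ 2 ≤ x ⬝ᵥ x) {t : n → ℝ} (ht : ∀ i, |t i| ≤ 1) :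
    IsContraction (∑ i, t i • Matrix.vecMulVec (u i) (v i)) := by
  intro x
  have h1 : (∑ i, t i • Matrix.vecMulVec (u i) (v i)) *ᵥ x = ∑ i, (t i * (v i ⬝ᵥ x)) • u i := by
    rw [Matrix.sum_mulVec]
    refine Finset.sum_congr rfl fun i _ => ?_
    rw [Matrix.smul_mulVec, Matrix.vecMulVec_mulVec]
    simp [smul_smul]
  rw [h1, sum_dotProduct]
  refine le_trans (Finset.sum_le_sum fun i _ => ?_) (hv x)
  rw [dotProduct_sum, Finset.sum_eq_single i]
  · rw [smul_dotProduct, dotProduct_smul, smul_eq_mul, smul_eq_mul]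
    have h2 : t i ^ 2 ≤ 1 := by
      rw [← sq_abs]; exact pow_le_one₀ (abs_nonneg _) (ht i)
    have h3 := hu1 i
    have h4 := dotProduct_self_nonneg' (u i)
    calc _ = (v i ⬝ᵥ x) ^ 2 * (t i ^ 2 * (u i ⬝ᵥ u i)) := by ring
      _ ≤ (v i ⬝ᵥ x) ^ 2 * 1 :=
        mul_le_mul_of_nonneg_left (mul_le_one₀ h2 h4 h3) (sq_nonneg _)
      _ = _ := mul_one _
  · intro j _ hj
    rw [smul_dotProduct, dotProduct_smul, hu i j (Ne.symm hj)]
    simp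
  · simp

/-- A linear program over `c`, bounded by a dual certificate: `σ k` is the multiplier of the budget
`∑ |c i| ≤ k`, and `(σ i - σ k)⁺` is that of `|c i| ≤ 1`. -/
theorem sum_mul_le_sum_range {n k : ℕ} {σ : ℕ → ℝ} (hσ : Antitone σ) (hσ0 : ∀ i, 0 ≤ σ i)
    {c : Fin n → ℝ} (hc : ∀ i, |c i| ≤ 1) (hk : ∑ i, |c i| ≤ k) :
    ∑ i : Fin n, σ i * c i ≤ ∑ i ∈ Finset.range k, σ i := by
  -- By monotonicity `f` vanishes from index `k` on, so its sum never exceeds the sum of its first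
  -- `k` values, whether or not `n` exceeds `k`.
  set f : ℕ → ℝ := fun i => max (σ i - σ k) 0
  have hf : ∑ i : Fin n, f i ≤ ∑ i ∈ Finset.range k, f i := by
    rw [← Finset.sum_range f]
    calc _ ≤ ∑ i ∈ Finset.range (max n k), f i :=
          Finset.sum_le_sum_of_subset_of_nonneg (by simp) fun _ _ _ => le_max_right _ _
      _ = _ := by
        symm
        refine Finset.sum_subset (by simp) fun i _ hi => ?_
        rw [Finset.mem_range, not_lt] at hi
        exact max_eq_right (sub_nonpos.2 (hσ hi))
  have hf' : ∑ i ∈ Finset.range k, f i = ∑ i ∈ Finset.range k, σ i - k * σ k := by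
    rw [Finset.sum_congr rfl (g := fun i => σ i - σ k), Finset.sum_sub_distrib]
    · simp
    · intro i hi
      exact max_eq_left (sub_nonneg.2 (hσ (Finset.mem_range.1 hi).le))
  calc ∑ i : Fin n, σ i * c i ≤ ∑ i : Fin n, (f i + σ k * |c i|) := by
        refine Finset.sum_le_sum fun i _ => ?_
        have h1 : σ i * c i ≤ σ i * |c i| :=
          mul_le_mul_of_nonneg_left (le_abs_self _) (hσ0 _)
        have h2 : (σ i - σ k) * |c i| ≤ f i * |c i| :=
          mul_le_mul_of_nonneg_right (le_max_left _ _) (abs_nonneg _)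
        have h3 : f i * |c i| ≤ f i := mul_le_of_le_one_right (le_max_right _ _) (hc i)
        linarith
    _ ≤ _ := by
        rw [Finset.sum_add_distrib, ← Finset.mul_sum]
        have := mul_le_mul_of_nonneg_left hk (hσ0 k)
        linarith

theorem frob_sum_vecMulVec {n : Type*} [Fintype n] (M : Matrix ι κ ℝ) (t : n → ℝ)
    (u : n → ι → ℝ) (v : n → κ → ℝ) :
    frob M (∑ i, t i • Matrix.vecMulVec (u i) (v i)) = ∑ i, t i * (u i ⬝ᵥ M *ᵥ v i) := by
  simp [map_sum, frob_vecMulVec]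

variable [DecidableEq κ]

theorem nuclearNorm_eq (M : Matrix ι κ ℝ) :
    nuclearNorm M = ∑ i : Fin (Fintype.card κ), singVal M i :=
  Finset.sum_range _

theorem sigmaSum_one (M : Matrix ι κ ℝ) : sigmaSum 1 M = spectralNorm M := by
  simp [sigmaSum, spectralNorm]

theorem sigmaSum_nonneg (k : ℕ) (M : Matrix ι κ ℝ) : 0 ≤ sigmaSum k M :=
  Finset.sum_nonneg fun _ _ => singVal_nonneg _ _

theorem nuclearNorm_nonneg (M : Matrix ι κ ℝ) : 0 ≤ nuclearNorm M := sigmaSum_nonneg _ _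

theorem sigmaSum_eq_sum_fin (k : ℕ) (M : Matrix ι κ ℝ) :
    sigmaSum k M = ∑ i : Fin (Fintype.card κ), if (i : ℕ) < k then singVal M i else 0 := by
  rw [← Finset.sum_range fun i => if i < k then singVal M i else 0, sigmaSum,
    ← Finset.sum_filter]
  symm
  refine Finset.sum_subset (by intro i; simp) fun i hi hi' => ?_
  refine singVal_of_card_le M ?_
  by_contra! h
  exact hi' (by simpa [h] using hi)

theorem sigmaSum_le_nuclearNorm (k : ℕ) (M : Matrix ι κ ℝ) : sigmaSum k M ≤ nuclearNorm M := by
  rw [sigmaSum_eq_sum_fin, nuclearNorm_eq]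
  exact Finset.sum_le_sum fun i _ => by split_ifs <;> simp [singVal_nonneg]

theorem spectralNorm_le_nuclearNorm (M : Matrix ι κ ℝ) : spectralNorm M ≤ nuclearNorm M :=
  sigmaSum_one M ▸ sigmaSum_le_nuclearNorm 1 M

theorem IsContraction.frob_le_nuclearNorm {N : Matrix ι κ ℝ} (h : IsContraction N)
    (M : Matrix ι κ ℝ) : frob M N ≤ nuclearNorm M := by
  obtain ⟨u, v, hu, hu1, hu2, hv, hbu, hbv, hM⟩ := exists_svd M
  rw [frob_comm, hM, frob_sum_vecMulVec, ← hM, nuclearNorm_eq]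
  refine Finset.sum_le_sum fun i _ => ?_
  refine mul_le_of_le_one_right (singVal_nonneg _ _) ?_
  exact (le_abs_self _).trans (h.abs_dotProduct_mulVec_le_one (hu1 i) (by simp [hv]))

theorem frob_svd {M : Matrix ι κ ℝ} {u : Fin (Fintype.card κ) → ι → ℝ}
    {v : Fin (Fintype.card κ) → κ → ℝ}
    (hu : ∀ i : Fin (Fintype.card κ), singVal M i ≠ 0 → u i ⬝ᵥ u i = 1)
    (hv : ∀ i j, v i ⬝ᵥ v j = if i = j then 1 else 0)
    (hM : M = ∑ i : Fin (Fintype.card κ), singVal M i • Matrix.vecMulVec (u i) (v i))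
    (t : Fin (Fintype.card κ) → ℝ) :
    frob M (∑ i, t i • Matrix.vecMulVec (u i) (v i)) = ∑ i, t i * singVal M i := by
  rw [frob_sum_vecMulVec]
  refine Finset.sum_congr rfl fun i _ => ?_
  congr 1
  have : M *ᵥ v i = singVal M i • u i := by
    conv_lhs => rw [hM]
    rw [Matrix.sum_mulVec, Finset.sum_eq_single i]
    · rw [Matrix.smul_mulVec, Matrix.vecMulVec_mulVec]
      simp [hv]
    · intro j _ hj
      rw [Matrix.smul_mulVec, Matrix.vecMulVec_mulVec]
      simp [hv, hj]
    · simp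
  rw [this, dotProduct_smul, smul_eq_mul]
  by_cases h : singVal M i = 0
  · simp [h]
  · rw [hu i h, mul_one]

/-- The witness is the polar factor `∑ uᵢ vᵢᵀ`. -/
theorem exists_isContraction_frob_eq (M : Matrix ι κ ℝ) :
    ∃ N : Matrix ι κ ℝ, IsContraction N ∧ frob M N = nuclearNorm M := by
  obtain ⟨u, v, hu, hu1, hu2, hv, hbu, hbv, hM⟩ := exists_svd M
  refine ⟨_, isContraction_sum_vecMulVec hu hu1 hbv (t := fun _ => 1) (by simp), ?_⟩
  rw [frob_svd hu2 hv hM, nuclearNorm_eq]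
  simp

/-- A function that is attained as the largest pairing with a symmetric set is a seminorm. -/
noncomputable def seminormOfDual (f : Matrix ι κ ℝ → ℝ) (S : Set (Matrix ι κ ℝ))
    (hS : ∀ N ∈ S, -N ∈ S)
    (hle : ∀ M, ∀ N ∈ S, frob M N ≤ f M) (hex : ∀ M, ∃ N ∈ S, frob M N = f M) :
    Seminorm ℝ (Matrix ι κ ℝ) :=
  Seminorm.ofSMulLE f
    (by
      obtain ⟨N, _, h⟩ := hex 0
      rw [← h, map_zero]; rfl)
    (fun M M' => by
      obtain ⟨N, hN, h⟩ := hex (M + M')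
      rw [← h, map_add]
      exact add_le_add (hle _ _ hN) (hle _ _ hN))
    (fun c M => by
      obtain ⟨N, hN, h⟩ := hex (c • M)
      rw [← h, map_smul, Real.norm_eq_abs]
      have h1 : |frob M N| ≤ f M := by
        refine abs_le'.2 ⟨hle _ _ hN, ?_⟩
        rw [← map_neg]
        exact hle _ _ (hS _ hN)
      calc _ ≤ |c * frob M N| := le_abs_self _
        _ = |c| * |frob M N| := abs_mul _ _
        _ ≤ _ := mul_le_mul_of_nonneg_left h1 (abs_nonneg _))

/-- The nuclear norm as a seminorm. -/
noncomputable def nuclearSeminorm : Seminorm ℝ (Matrix ι κ ℝ) :=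
  seminormOfDual nuclearNorm {N | IsContraction N} (fun _ h => h.neg)
    (fun M _ h => h.frob_le_nuclearNorm M) exists_isContraction_frob_eq

theorem nuclearSeminorm_apply (M : Matrix ι κ ℝ) : nuclearSeminorm M = nuclearNorm M := rfl

/-- Duality avoids computing singular values: the pairing of `x yᵀ` with a contraction `N` is `⟨x,
Ny⟩`. -/
theorem nuclearNorm_vecMulVec_le (x : ι → ℝ) (y : κ → ℝ) :
    nuclearNorm (Matrix.vecMulVec x y) ≤ √(x ⬝ᵥ x) * √(y ⬝ᵥ y) := by
  obtain ⟨N, hN, h⟩ := exists_isContraction_frob_eq (Matrix.vecMulVec x y)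
  rw [← h, frob_comm, frob_vecMulVec]
  exact (le_abs_self _).trans (hN.abs_dotProduct_mulVec_le x y)

theorem nuclearNorm_sum_le {n : Type*} (s : Finset n) (M : n → Matrix ι κ ℝ) :
    nuclearNorm (∑ i ∈ s, M i) ≤ ∑ i ∈ s, nuclearNorm (M i) := by
  simp only [← nuclearSeminorm_apply]
  exact Finset.le_sum_of_subadditive _ (map_zero _).le (map_add_le_add _) _ _

theorem nuclearNorm_sum_smul_vecMulVec_le {n : Type*} [Fintype n] {u : n → ι → ℝ}
    {v : n → κ → ℝ} (hu1 : ∀ i, u i ⬝ᵥ u i ≤ 1) (hv1 : ∀ i, v i ⬝ᵥ v i ≤ 1) {t : n → ℝ}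
    (ht : ∀ i, 0 ≤ t i) :
    nuclearNorm (∑ i, t i • Matrix.vecMulVec (u i) (v i)) ≤ ∑ i, t i := by
  refine (nuclearNorm_sum_le _ _).trans (Finset.sum_le_sum fun i _ => ?_)
  rw [← nuclearSeminorm_apply, map_smul_eq_mul, Real.norm_of_nonneg (ht i), nuclearSeminorm_apply]
  refine mul_le_of_le_one_right (ht i) ((nuclearNorm_vecMulVec_le _ _).trans ?_)
  exact mul_le_one₀ (Real.sqrt_le_one.2 (hu1 i)) (Real.sqrt_nonneg _) (Real.sqrt_le_one.2 (hv1 i))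

theorem isContraction_iff_spectralNorm_le_one (M : Matrix ι κ ℝ) :
    IsContraction M ↔ spectralNorm M ≤ 1 := by
  obtain ⟨u, v, hu, hu1, hu2, hv, hbu, hbv, hM⟩ := exists_svd M
  constructor
  · intro h
    -- Without columns there is no top singular pair to test on, and `singVal M 0` is the default
    -- value 0.
    rcases Nat.eq_zero_or_pos (Fintype.card κ) with h0 | h0
    · rw [spectralNorm, singVal_of_card_le M h0.le]
      exact zero_le_one
    · have h1 := frob_svd hu2 hv hM (Pi.single ⟨0, h0⟩ 1)
      rw [frob_sum_vecMulVec] at h1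
      simp only [Pi.single_apply, ite_mul, one_mul, zero_mul, Finset.sum_ite_eq',
        Finset.mem_univ, if_true] at h1
      rw [spectralNorm, ← h1]
      exact (le_abs_self _).trans (h.abs_dotProduct_mulVec_le_one (hu1 _) (by simp [hv]))
  · intro h
    rw [hM]
    refine isContraction_sum_vecMulVec hu hu1 hbv fun i => ?_
    rw [abs_of_nonneg (singVal_nonneg _ _)]
    exact (singVal_antitone M (Nat.zero_le _)).trans h

/-- The easy half of Ky Fan's variational description of `Σ_k`. -/
theorem frob_le_sigmaSum {k : ℕ} {N : Matrix ι κ ℝ} (hN : nuclearNorm N ≤ k)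
    (hN1 : IsContraction N) (M : Matrix ι κ ℝ) : frob M N ≤ sigmaSum k M := by
  obtain ⟨u, v, hu, hu1, hu2, hv, hbu, hbv, hM⟩ := exists_svd M
  rw [frob_comm, hM, frob_sum_vecMulVec, ← hM]
  refine sum_mul_le_sum_range (singVal_antitone M) (singVal_nonneg M)
    (fun i => hN1.abs_dotProduct_mulVec_le_one (hu1 i) (by simp [hv])) (le_trans ?_ hN)
  -- With sign weights the pairing with `N` becomes `∑ |⟨uᵢ, N vᵢ⟩|`, so the coefficients obey the
  -- budget `‖N‖ ≤ k`.
  have h1 := (isContraction_sum_vecMulVec hu hu1 hbv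
    (t := fun i => SignType.sign (u i ⬝ᵥ N *ᵥ v i)) (fun i => by
      rcases lt_trichotomy (u i ⬝ᵥ N *ᵥ v i) 0 with h | h | h <;> simp [h])).frob_le_nuclearNorm N
  rw [frob_sum_vecMulVec] at h1
  simpa [sign_mul_self] using h1

/-- The maximum in Ky Fan's variational description of `Σ_k` is attained. -/
theorem exists_frob_eq_sigmaSum (k : ℕ) (M : Matrix ι κ ℝ) :
    ∃ N : Matrix ι κ ℝ, (nuclearNorm N ≤ k ∧ IsContraction N) ∧ frob M N = sigmaSum k M := by
  obtain ⟨u, v, hu, hu1, hu2, hv, hbu, hbv, hM⟩ := exists_svd M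
  -- The polar factor truncated to the top `k` singular pairs. There may be fewer than `k` pairs, so
  -- its nuclear norm is only bounded by `k`.
  set t : Fin (Fintype.card κ) → ℝ := fun i => if (i : ℕ) < k then 1 else 0
  have ht : ∀ i, |t i| ≤ 1 := fun i => by simp only [t]; split_ifs <;> simp
  have ht0 : ∀ i, 0 ≤ t i := fun i => by simp only [t]; split_ifs <;> simp
  refine ⟨_, ⟨(nuclearNorm_sum_smul_vecMulVec_le hu1 (fun i => by simp [hv]) ht0).trans ?_,
    isContraction_sum_vecMulVec hu hu1 hbv ht⟩, ?_⟩
  · simp only [t]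
    rw [← Finset.sum_range fun i => if i < k then (1 : ℝ) else 0, ← Finset.sum_filter,
      Finset.sum_const, nsmul_eq_mul, mul_one, Nat.cast_le]
    calc _ ≤ (Finset.range k).card := Finset.card_le_card (by intro i; simp)
      _ = k := Finset.card_range k
  · rw [frob_svd hu2 hv hM, sigmaSum_eq_sum_fin]
    simp [t]

/-- `Σ_k` as a seminorm. -/
noncomputable def sigmaSeminorm (k : ℕ) : Seminorm ℝ (Matrix ι κ ℝ) :=
  seminormOfDual (sigmaSum k) {N | nuclearNorm N ≤ k ∧ IsContraction N}
    (fun N h => ⟨by rw [← nuclearSeminorm_apply, map_neg_eq_map]; exact h.1, h.2.neg⟩)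
    (fun M _ h => frob_le_sigmaSum h.1 h.2 M) (exists_frob_eq_sigmaSum k)

theorem sigmaSeminorm_one_apply (M : Matrix ι κ ℝ) : sigmaSeminorm 1 M = spectralNorm M :=
  sigmaSum_one M

/-- The definition of singular values favours the columns; duality restores the symmetry, since
contractions are stable under transposition. -/
theorem nuclearNorm_transpose_le [DecidableEq ι] (M : Matrix ι κ ℝ) :
    nuclearNorm Mᵀ ≤ nuclearNorm M := by
  obtain ⟨N, hN, h⟩ := exists_isContraction_frob_eq Mᵀ
  rw [← h, ← frob_transpose, Matrix.transpose_transpose]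
  exact hN.transpose.frob_le_nuclearNorm M

/-- `M` is itself an admissible contraction in the dual description. This is the source of the
radius `√k` in the rank-one constraint. -/
theorem frob_self_le_nuclearNorm {M : Matrix ι κ ℝ} (h : spectralNorm M ≤ 1) :
    frob M M ≤ nuclearNorm M :=
  ((isContraction_iff_spectralNorm_le_one M).2 h).frob_le_nuclearNorm M

/-- Pairing with the contractions `±e_a e_bᵀ`. It yields both the boundedness of nuclear norm balls
and definiteness. -/
theorem abs_apply_le_nuclearNorm (M : Matrix ι κ ℝ) (a : ι) (b : κ) :
    |M a b| ≤ nuclearNorm M := by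
  classical
  have h1 : IsContraction (Matrix.vecMulVec (Pi.single a 1) (Pi.single b 1) : Matrix ι κ ℝ) := by
    rw [isContraction_iff_spectralNorm_le_one]
    refine (spectralNorm_le_nuclearNorm _).trans ((nuclearNorm_vecMulVec_le _ _).trans ?_)
    simp
  have h2 := h1.frob_le_nuclearNorm M
  have h3 := h1.neg.frob_le_nuclearNorm M
  rw [map_neg] at h3
  rw [frob_vecMulVec] at h2 h3
  refine abs_le'.2 ⟨?_, ?_⟩
  · simpa using h2
  · simpa using h3

end Duality

/-! ### Contractions and nuclear norms of Kronecker products. -/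

section Kronecker

variable {ι κ ι' κ' : Type*} [Fintype ι] [Fintype κ] [Fintype ι'] [Fintype κ']

theorem IsContraction.kronecker_one [DecidableEq ι'] {M : Matrix ι κ ℝ} (h : IsContraction M) :
    IsContraction (M ⊗ₖ (1 : Matrix ι' ι' ℝ)) := by
  intro x
  have h1 : ∀ a b, ((M ⊗ₖ (1 : Matrix ι' ι' ℝ)) *ᵥ x) (a, b) = (M *ᵥ fun c => x (c, b)) a := by
    intro a b
    simp [Matrix.mulVec, dotProduct, Fintype.sum_prod_type, Matrix.one_apply]
  simp only [dotProduct, Fintype.sum_prod_type_right, h1]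
  exact Finset.sum_le_sum fun b _ => h fun c => x (c, b)

theorem IsContraction.one_kronecker [DecidableEq ι'] {M : Matrix ι κ ℝ} (h : IsContraction M) :
    IsContraction ((1 : Matrix ι' ι' ℝ) ⊗ₖ M) := by
  intro x
  have h1 : ∀ a b, (((1 : Matrix ι' ι' ℝ) ⊗ₖ M) *ᵥ x) (a, b) = (M *ᵥ fun c => x (a, c)) b := by
    intro a b
    simp [Matrix.mulVec, dotProduct, Fintype.sum_prod_type, Matrix.one_apply]
  simp only [dotProduct, Fintype.sum_prod_type, h1]
  exact Finset.sum_le_sum fun b _ => h fun c => x (b, c)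

/-- Each factor of `M ⊗ N = (M ⊗ 1)(1 ⊗ N)` acts slice by slice. -/
theorem IsContraction.kronecker [DecidableEq κ] [DecidableEq ι'] {M : Matrix ι κ ℝ}
    {N : Matrix ι' κ' ℝ} (hM : IsContraction M) (hN : IsContraction N) :
    IsContraction (M ⊗ₖ N) := by
  have : M ⊗ₖ N = (M ⊗ₖ (1 : Matrix ι' ι' ℝ)) * ((1 : Matrix κ κ ℝ) ⊗ₖ N) := by
    rw [← Matrix.mul_kronecker_mul, Matrix.mul_one, Matrix.one_mul]
  rw [this]
  exact hM.kronecker_one.mul hN.one_kronecker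

theorem dotProduct_mul_mul {α β : Type*} [Fintype α] [Fintype β] (x : α → ℝ) (y : β → ℝ) :
    (fun c : α × β => x c.1 * y c.2) ⬝ᵥ (fun c : α × β => x c.1 * y c.2)
      = (x ⬝ᵥ x) * (y ⬝ᵥ y) := by
  simp only [dotProduct, Fintype.sum_prod_type, Finset.sum_mul_sum]
  exact Finset.sum_congr rfl fun _ _ => Finset.sum_congr rfl fun _ _ => by ring

/-- Multiplying out the two decompositions writes `M ⊗ N` as a sum of rank-one matrices with weights
`σᵢ(M) σⱼ(N)`. The triangle inequality suffices; the singular values of the product need not be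
identified. -/
theorem nuclearNorm_kronecker_le [DecidableEq κ] [DecidableEq κ'] (M : Matrix ι κ ℝ)
    (N : Matrix ι' κ' ℝ) : nuclearNorm (M ⊗ₖ N) ≤ nuclearNorm M * nuclearNorm N := by
  obtain ⟨u, v, -, hu1, -, hv, -, -, hM⟩ := exists_svd M
  obtain ⟨u', v', -, hu1', -, hv', -, -, hN⟩ := exists_svd N
  have h : M ⊗ₖ N = ∑ ij : Fin (Fintype.card κ) × Fin (Fintype.card κ'),
      (singVal M ij.1 * singVal N ij.2) •
        Matrix.vecMulVec (fun c : ι × ι' => u ij.1 c.1 * u' ij.2 c.2)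
          (fun c : κ × κ' => v ij.1 c.1 * v' ij.2 c.2) := by
    ext a b
    conv_lhs => rw [hM, hN]
    simp only [Matrix.kroneckerMap_apply, Matrix.sum_apply, Matrix.smul_apply,
      Matrix.vecMulVec_apply, smul_eq_mul, Finset.sum_mul_sum, Fintype.sum_prod_type]
    exact Finset.sum_congr rfl fun _ _ => Finset.sum_congr rfl fun _ _ => by ring
  rw [h]
  refine (nuclearNorm_sum_smul_vecMulVec_le ?_ ?_ ?_).trans ?_
  · intro ij
    rw [dotProduct_mul_mul]
    exact mul_le_one₀ (hu1 _) (dotProduct_self_nonneg' _) (hu1' _)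
  · intro ij
    rw [dotProduct_mul_mul]
    simp [hv, hv']
  · exact fun ij => mul_nonneg (singVal_nonneg _ _) (singVal_nonneg _ _)
  · rw [nuclearNorm_eq, nuclearNorm_eq, Finset.sum_mul_sum, Fintype.sum_prod_type]

end Kronecker

/-! ### Continuity of seminorms and compactness of the feasible sets. -/

section Compactness

theorem continuous_seminorm {E : Type*} [NormedAddCommGroup E] [NormedSpace ℝ E]
    [FiniteDimensional ℝ E] (p : Seminorm ℝ E) : Continuous p :=
  (ConvexOn.locallyLipschitz p.convexOn).continuous

theorem continuous_seminorm_matrix {ι κ : Type*} [Fintype ι] [Fintype κ]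
    (p : Seminorm ℝ (Matrix ι κ ℝ)) : Continuous p := by
  let _ : NormedAddCommGroup (Matrix ι κ ℝ) := Matrix.normedAddCommGroup
  let _ : NormedSpace ℝ (Matrix ι κ ℝ) := Matrix.normedSpace
  exact continuous_seminorm p

theorem isCompact_matrix_of_abs_le {ι κ : Type*} [Fintype ι] [Fintype κ]
    {S : Set (Matrix ι κ ℝ)} (hS : IsClosed S) {C : ℝ} (hC : ∀ M ∈ S, ∀ a b, |M a b| ≤ C) :
    IsCompact S := by
  have h1 : IsCompact (Set.univ.pi fun _ : ι => Set.univ.pi fun _ : κ => Set.Icc (-C) C) :=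
    isCompact_univ_pi fun _ => isCompact_univ_pi fun _ => isCompact_Icc
  refine IsCompact.of_isClosed_subset h1 hS fun M hM => ?_
  exact fun a _ b _ => abs_le.1 (hC M hM a b)

/-- A definite seminorm dominates a positive multiple of the sup norm: take its minimum over the
unit sphere. -/
theorem isCompact_seminorm_ball {n : Type*} [Fintype n] (φ : Seminorm ℝ (n → ℝ))
    (hφ : ∀ v, φ v = 0 → v = 0) : IsCompact {v | φ v ≤ 1} := by
  have hc := continuous_seminorm φ
  obtain ⟨c, hc0, hcle⟩ : ∃ c : ℝ, 0 < c ∧ ∀ v, c * ‖v‖ ≤ φ v := by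
    -- The sphere is empty exactly when the space is zero; any positive constant then works.
    rcases (Metric.sphere (0 : n → ℝ) 1).eq_empty_or_nonempty with h | h
    · refine ⟨1, one_pos, fun v => ?_⟩
      have hv : v = 0 := by
        by_contra hv
        have : ‖v‖⁻¹ • v ∈ Metric.sphere (0 : n → ℝ) 1 := by
          simp [norm_smul, hv]
        rw [h] at this
        exact this
      simp [hv]
    · obtain ⟨v₀, hv₀, hmin⟩ := (isCompact_sphere (0 : n → ℝ) 1).exists_isMinOn h hc.continuousOn
      have hv0 : v₀ ≠ 0 := by
        rintro rfl
        simp at hv₀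
      refine ⟨φ v₀, lt_of_le_of_ne (apply_nonneg φ v₀) fun h => hv0 (hφ _ h.symm), fun v => ?_⟩
      by_cases hv : v = 0
      · simp [hv]
      · have h1 : ‖v‖⁻¹ • v ∈ Metric.sphere (0 : n → ℝ) 1 := by
          simp [norm_smul, hv]
        have h2 : φ v₀ ≤ φ (‖v‖⁻¹ • v) := hmin h1
        rw [map_smul_eq_mul, norm_inv, norm_norm] at h2
        have h3 : 0 < ‖v‖ := norm_pos_iff.2 hv
        calc φ v₀ * ‖v‖ ≤ ‖v‖⁻¹ * φ v * ‖v‖ := mul_le_mul_of_nonneg_right h2 h3.le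
          _ = φ v := by field_simp
  refine IsCompact.of_isClosed_subset (isCompact_closedBall (0 : n → ℝ) c⁻¹)
    (isClosed_le hc continuous_const) fun v hv => ?_
  rw [mem_closedBall_zero_iff, ← one_div, le_div_iff₀ hc0, mul_comm]
  exact (hcle v).trans hv

variable {ι κ : Type*} [Fintype ι] [Fintype κ] [DecidableEq κ]

theorem continuous_sigmaSum (k : ℕ) : Continuous (sigmaSum k : Matrix ι κ ℝ → ℝ) :=
  continuous_seminorm_matrix (sigmaSeminorm k)

theorem continuous_nuclearNorm : Continuous (nuclearNorm : Matrix ι κ ℝ → ℝ) :=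
  continuous_sigmaSum _

theorem continuous_spectralNorm : Continuous (spectralNorm : Matrix ι κ ℝ → ℝ) :=
  continuous_seminorm_matrix (sigmaSeminorm 1) |>.congr sigmaSeminorm_one_apply

theorem isCompact_nuclearNorm_le (r : ℝ) : IsCompact {M : Matrix ι κ ℝ | nuclearNorm M ≤ r} :=
  isCompact_matrix_of_abs_le (isClosed_le continuous_nuclearNorm continuous_const)
    fun M hM a b => (abs_apply_le_nuclearNorm M a b).trans hM

theorem convex_nuclearNorm_le (r : ℝ) : Convex ℝ {M : Matrix ι κ ℝ | nuclearNorm M ≤ r} := by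
  simpa [Set.sep_univ, nuclearSeminorm_apply] using
    (nuclearSeminorm (ι := ι) (κ := κ)).convexOn.convex_le r

theorem convex_spectralNorm_le (r : ℝ) : Convex ℝ {M : Matrix ι κ ℝ | spectralNorm M ≤ r} := by
  simpa [Set.sep_univ, sigmaSeminorm_one_apply] using
    (sigmaSeminorm (ι := ι) (κ := κ) 1).convexOn.convex_le r

theorem eq_zero_of_nuclearNorm_eq_zero {M : Matrix ι κ ℝ} (h : nuclearNorm M = 0) : M = 0 := by
  ext a b
  exact abs_nonpos_iff.1 (h ▸ abs_apply_le_nuclearNorm M a b)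

end Compactness

/-! ### The sets `Z_k`, `Z*_k`, `U_k`, the bounds on `Opt`, and the sufficient condition. -/

section Sets

variable {p q m : ℕ}

theorem pairing_eq_frob (T U : BigMatrix p q) : pairing T U = frob T U := rfl

theorem setZ_subset_setZstar (k : ℕ) : setZ p q k ⊆ setZstar p q k := by
  rintro U ⟨h, ⟨hk, h1⟩, w, hw, rfl⟩
  have hw1 : spectralNorm w ≤ 1 := (spectralNorm_le_nuclearNorm w).trans hw
  have ch := (isContraction_iff_spectralNorm_le_one h).2 h1
  have cw := (isContraction_iff_spectralNorm_le_one w).2 hw1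
  have hmul : ∀ {x : ℝ}, x ≤ k → x * nuclearNorm w ≤ k := fun {x} hx =>
    (mul_le_mul_of_nonneg_right hx (nuclearNorm_nonneg w)).trans
      (mul_le_of_le_one_right (Nat.cast_nonneg k) hw)
  refine ⟨?_, ?_, ?_, ?_, ?_⟩
  · exact (nuclearNorm_kronecker_le _ _).trans (hmul ((nuclearNorm_transpose_le h).trans hk))
  · exact (isContraction_iff_spectralNorm_le_one _).1 (ch.transpose.kronecker cw)
  · rw [rearr1_kronecker]
    exact (nuclearNorm_kronecker_le _ _).trans (hmul hk)
  · rw [rearr1_kronecker]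
    exact (isContraction_iff_spectralNorm_le_one _).1 (ch.kronecker cw)
  · rw [rearr2_kronecker]
    refine (nuclearNorm_vecMulVec_le _ _).trans ?_
    have e1 : (fun a : Fin p × Fin q => h a.1 a.2) ⬝ᵥ (fun a : Fin p × Fin q => h a.1 a.2)
        = frob h h := by
      simp [dotProduct, frob_apply, Fintype.sum_prod_type]
    have e2 : (fun b : Fin q × Fin p => w b.2 b.1) ⬝ᵥ (fun b : Fin q × Fin p => w b.2 b.1)
        = frob w w := by
      simp [dotProduct, frob_apply, Fintype.sum_prod_type_right]
    rw [e1, e2]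
    have f1 : √(frob h h) ≤ √(k : ℝ) :=
      Real.sqrt_le_sqrt ((frob_self_le_nuclearNorm h1).trans hk)
    have f2 : √(frob w w) ≤ 1 :=
      Real.sqrt_le_one.2 ((frob_self_le_nuclearNorm hw1).trans hw)
    exact (mul_le_mul f1 f2 (Real.sqrt_nonneg _) (Real.sqrt_nonneg _)).trans_eq (mul_one _)

theorem setZstar_subset_setU (k : ℕ) : setZstar p q k ⊆ setU p q k :=
  fun _ hU => ⟨hU.1, hU.2.1⟩

theorem convex_setZstar (k : ℕ) : Convex ℝ (setZstar p q k) :=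
  (convex_nuclearNorm_le _).inter <| (convex_spectralNorm_le _).inter <|
    ((convex_nuclearNorm_le _).linear_preimage rearr1).inter <|
    ((convex_spectralNorm_le _).linear_preimage rearr1).inter <|
    (convex_nuclearNorm_le _).linear_preimage rearr2

theorem continuous_rearr1 : Continuous (rearr1 (p := p) (q := q)) :=
  continuous_matrix fun _ _ => continuous_id.matrix_elem _ _

theorem continuous_rearr2 : Continuous (rearr2 (p := p) (q := q)) :=
  continuous_matrix fun _ _ => continuous_id.matrix_elem _ _

theorem isCompact_setU (k : ℕ) : IsCompact (setU p q k) :=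
  (isCompact_nuclearNorm_le _).inter_right (isClosed_le continuous_spectralNorm continuous_const)

theorem isCompact_setZstar (k : ℕ) : IsCompact (setZstar p q k) := by
  have : IsClosed (setZstar p q k) :=
    (isClosed_le continuous_nuclearNorm continuous_const).inter <|
      (isClosed_le continuous_spectralNorm continuous_const).inter <|
      (isClosed_le (continuous_nuclearNorm.comp continuous_rearr1) continuous_const).inter <|
      (isClosed_le (continuous_spectralNorm.comp continuous_rearr1) continuous_const).inter <|
      isClosed_le (continuous_nuclearNorm.comp continuous_rearr2) continuous_const
  exact (isCompact_setU k).of_isClosed_subset this (setZstar_subset_setU k)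

theorem zero_mem_setZstar (k : ℕ) : (0 : BigMatrix p q) ∈ setZstar p q k := by
  have h1 : ∀ {ι κ : Type} [Fintype ι] [Fintype κ] [DecidableEq κ],
      nuclearNorm (0 : Matrix ι κ ℝ) = 0 := fun {ι κ} _ _ _ =>
    map_zero (nuclearSeminorm (ι := ι) (κ := κ))
  have h2 : ∀ {ι κ : Type} [Fintype ι] [Fintype κ] [DecidableEq κ],
      spectralNorm (0 : Matrix ι κ ℝ) = 0 := fun {ι κ} _ _ _ => by
    rw [← sigmaSeminorm_one_apply, map_zero]
  simp [setZstar, h1, h2]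

theorem isGreatest_sSup_image {E : Type*} [TopologicalSpace E] {S : Set E} (hS : IsCompact S)
    (hne : S.Nonempty) {f : E → ℝ} (hf : Continuous f) : IsGreatest (f '' S) (sSup (f '' S)) :=
  (hS.image hf).isGreatest_sSup (hne.image f)

theorem relaxValues_eq_image (S T : Set (BigMatrix p q)) (W : Signal p q →ₗ[ℝ] Signal p q) :
    relaxValues S T W = (fun x : BigMatrix p q × BigMatrix p q =>
      pairing (theta W) (x.1 + x.2)) '' (S ×ˢ T) := by
  ext t
  constructor
  · rintro ⟨U, hU, V, hV, rfl⟩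
    exact ⟨(U, V), ⟨hU, hV⟩, rfl⟩
  · rintro ⟨⟨U, V⟩, ⟨hU, hV⟩, rfl⟩
    exact ⟨U, hU, V, hV, rfl⟩

theorem isGreatest_relaxValues {S T : Set (BigMatrix p q)} (hS : IsCompact S) (hT : IsCompact T)
    (hS0 : S.Nonempty) (hT0 : T.Nonempty) (W : Signal p q →ₗ[ℝ] Signal p q) :
    IsGreatest (relaxValues S T W) (sSup (relaxValues S T W)) := by
  rw [relaxValues_eq_image]
  refine isGreatest_sSup_image (hS.prod hT) (hS0.prod hT0) ?_
  unfold pairing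
  simp only [Matrix.add_apply]
  refine continuous_finsetSum _ fun a _ => continuous_finsetSum _ fun b _ => ?_
  exact continuous_const.mul ((continuous_fst.matrix_elem a b).add (continuous_snd.matrix_elem a b))

theorem isGreatest_optStar (s : ℕ) (W : Signal p q →ₗ[ℝ] Signal p q) :
    IsGreatest (relaxValues (setZstar p q s) (setZstar p q (2 * s)) W) (optStar s W) :=
  isGreatest_relaxValues (isCompact_setZstar _) (isCompact_setZstar _)
    ⟨0, zero_mem_setZstar _⟩ ⟨0, zero_mem_setZstar _⟩ W

theorem isGreatest_optBar (s : ℕ) (W : Signal p q →ₗ[ℝ] Signal p q) :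
    IsGreatest (relaxValues (setU p q s) (setU p q (2 * s)) W) (optBar s W) :=
  isGreatest_relaxValues (isCompact_setU _) (isCompact_setU _)
    ⟨0, setZstar_subset_setU _ (zero_mem_setZstar _)⟩
    ⟨0, setZstar_subset_setU _ (zero_mem_setZstar _)⟩ W

theorem isGreatest_opt (s : ℕ) (W : Signal p q →ₗ[ℝ] Signal p q) :
    IsGreatest (optValues s W) (opt s W) := by
  have h0 : nuclearNorm (0 : Signal p q) = 0 := map_zero (nuclearSeminorm (ι := Fin p) (κ := Fin q))
  refine isGreatest_sSup_image (isCompact_nuclearNorm_le 1) ⟨0, by simp [h0]⟩ ?_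
  exact continuous_seminorm_matrix (((sigmaSeminorm s).comp W) + (sigmaSeminorm (2 * s)).comp W)

theorem isGreatest_beta (s : ℕ) {φ : Seminorm ℝ (Fin m → ℝ)} (hφ : ∀ v, φ v = 0 → v = 0)
    (H : Signal p q →ₗ[ℝ] (Fin m → ℝ)) : IsGreatest (betaValues s φ H) (beta s φ H) := by
  refine isGreatest_sSup_image (isCompact_seminorm_ball φ hφ) ⟨0, by simp⟩ ?_
  exact continuous_seminorm
    (((sigmaSeminorm s).comp (conjMap H)) + (sigmaSeminorm (2 * s)).comp (conjMap H))

theorem optStar_le_optBar (s : ℕ) (W : Signal p q →ₗ[ℝ] Signal p q) :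
    optStar s W ≤ optBar s W := by
  obtain ⟨U, hU, V, hV, h⟩ := (isGreatest_optStar s W).1
  exact (isGreatest_optBar s W).2
    ⟨U, setZstar_subset_setU _ hU, V, setZstar_subset_setU _ hV, h⟩

/-- At a maximizer `z`, Ky Fan's optimal `N` for `Wz` turns `Σ_k(Wz)` into the pairing of `Θ[W]`
with `Nᵀ ⊗ z`, an element of `Z_k`. The choices for `k = s` and `k = 2s` are independent. -/
theorem opt_le_optStar (s : ℕ) (W : Signal p q →ₗ[ℝ] Signal p q) : opt s W ≤ optStar s W := by
  obtain ⟨z, hz, h⟩ := (isGreatest_opt s W).1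
  have key : ∀ k, ∃ U ∈ setZstar p q k, sigmaSum k (W z) = pairing (theta W) U := by
    intro k
    obtain ⟨N, ⟨hN, hN1⟩, e⟩ := exists_frob_eq_sigmaSum k (W z)
    refine ⟨Nᵀ ⊗ₖ z, setZ_subset_setZstar k
      ⟨N, ⟨hN, (isContraction_iff_spectralNorm_le_one N).1 hN1⟩, z, hz, rfl⟩, ?_⟩
    rw [pairing_theta, ← e, frob_eq_trace]
  obtain ⟨U, hU, eU⟩ := key s
  obtain ⟨V, hV, eV⟩ := key (2 * s)
  refine (isGreatest_optStar s W).2 ⟨U, hU, V, hV, ?_⟩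
  rw [pairing_eq_frob, map_add, ← pairing_eq_frob, ← pairing_eq_frob, ← eU, ← eV]
  exact h.symm

theorem pairing_theta_add_smul (a b : ℝ) (W W' : Signal p q →ₗ[ℝ] Signal p q)
    (U : BigMatrix p q) : pairing (theta (a • W + b • W')) U
      = a * pairing (theta W) U + b * pairing (theta W') U := by
  have : theta (a • W + b • W') = a • theta W + b • theta W' := by
    ext x y
    simp [theta]
  simp [pairing_eq_frob, this]

theorem convexOn_optStar (s : ℕ) :
    ConvexOn ℝ Set.univ (fun W : Signal p q →ₗ[ℝ] Signal p q => optStar s W) := by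
  refine ⟨convex_univ, fun W _ W' _ a b ha hb _ => ?_⟩
  obtain ⟨U, hU, V, hV, h⟩ := (isGreatest_optStar s (a • W + b • W')).1
  dsimp only
  rw [h, pairing_theta_add_smul, smul_eq_mul, smul_eq_mul]
  exact add_le_add
    (mul_le_mul_of_nonneg_left ((isGreatest_optStar s W).2 ⟨U, hU, V, hV, rfl⟩) ha)
    (mul_le_mul_of_nonneg_left ((isGreatest_optStar s W').2 ⟨U, hU, V, hV, rfl⟩) hb)

theorem conjMap_add_smul (a b : ℝ) (H H' : Signal p q →ₗ[ℝ] (Fin m → ℝ)) :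
    conjMap (a • H + b • H') = a • conjMap H + b • conjMap H' := by
  ext v i j
  simp [conjMap, add_dotProduct, smul_dotProduct]

/-- The residual is affine, not linear, in `H`; the condition `a + b = 1` splits the identity. -/
theorem residual_add_smul (A : Signal p q →ₗ[ℝ] (Fin m → ℝ)) {a b : ℝ} (hab : a + b = 1)
    (H H' : Signal p q →ₗ[ℝ] (Fin m → ℝ)) :
    residual A (a • H + b • H') = a • residual A H + b • residual A H' := by
  have h1 : (LinearMap.id : Signal p q →ₗ[ℝ] Signal p q)
      = a • LinearMap.id + b • LinearMap.id := by
    rw [← add_smul, hab, one_smul]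
  unfold residual
  rw [conjMap_add_smul, LinearMap.add_comp, LinearMap.smul_comp, LinearMap.smul_comp]
  conv_lhs => rw [h1]
  simp only [smul_sub]
  abel

theorem convexOn_optStar_residual (s : ℕ) (A : Signal p q →ₗ[ℝ] (Fin m → ℝ)) :
    ConvexOn ℝ Set.univ
      (fun H : Signal p q →ₗ[ℝ] (Fin m → ℝ) => optStar s (residual A H)) := by
  refine ⟨convex_univ, fun H _ H' _ a b ha hb hab => ?_⟩
  dsimp only
  rw [residual_add_smul A hab]
  exact (convexOn_optStar s).2 (Set.mem_univ _) (Set.mem_univ _) ha hb hab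

theorem convex_system (s : ℕ) (A : Signal p q →ₗ[ℝ] (Fin m → ℝ))
    {betaHat : (Signal p q →ₗ[ℝ] (Fin m → ℝ)) → ℝ} (hconv : ConvexOn ℝ Set.univ betaHat)
    (γ : ℝ) (β : EReal) :
    Convex ℝ {H : Signal p q →ₗ[ℝ] (Fin m → ℝ) |
      optStar s (residual A H) ≤ γ ∧ (betaHat H : EReal) ≤ β} := by
  have h1 : Convex ℝ {H : Signal p q →ₗ[ℝ] (Fin m → ℝ) | optStar s (residual A H) ≤ γ} := by
    simpa using (convexOn_optStar_residual s A).convex_le γ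
  have h2 : Convex ℝ {H | (betaHat H : EReal) ≤ β} := by
    induction β with
    | bot => simpa using convex_empty (𝕜 := ℝ) (E := Signal p q →ₗ[ℝ] (Fin m → ℝ))
    | top => simpa using convex_univ (𝕜 := ℝ) (E := Signal p q →ₗ[ℝ] (Fin m → ℝ))
    | coe r => simpa only [EReal.coe_le_coe_iff, Set.mem_univ, true_and] using hconv.convex_le r
  exact h1.inter h2

/-- Homogeneity: normalize `z` to nuclear norm 1, the case of norm 0 being `z = 0`. -/
theorem sigmaSum_add_le_opt_mul (s : ℕ) (W : Signal p q →ₗ[ℝ] Signal p q) (z : Signal p q) :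
    sigmaSum s (W z) + sigmaSum (2 * s) (W z) ≤ opt s W * nuclearNorm z := by
  set P : Seminorm ℝ (Signal p q) := (sigmaSeminorm s).comp W + (sigmaSeminorm (2 * s)).comp W
  change P z ≤ _
  by_cases hz : nuclearNorm z = 0
  · rw [eq_zero_of_nuclearNorm_eq_zero hz, map_zero, ← eq_zero_of_nuclearNorm_eq_zero hz, hz,
      mul_zero]
  · have hpos : 0 < nuclearNorm z := lt_of_le_of_ne (nuclearNorm_nonneg z) (Ne.symm hz)
    have h1 : P ((nuclearNorm z)⁻¹ • z) ≤ opt s W := by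
      refine (isGreatest_opt s W).2 ⟨_, ?_, rfl⟩
      rw [Set.mem_ofPred_eq, ← nuclearSeminorm_apply, map_smul_eq_mul,
        Real.norm_of_nonneg (inv_nonneg.2 hpos.le), nuclearSeminorm_apply, inv_mul_cancel₀ hz]
    rw [map_smul_eq_mul, Real.norm_of_nonneg (inv_nonneg.2 hpos.le)] at h1
    calc P z = (nuclearNorm z)⁻¹ * P z * nuclearNorm z := by field_simp
      _ ≤ _ := mul_le_mul_of_nonneg_right h1 hpos.le

theorem sigmaSum_add_le_beta_mul (s : ℕ) {φ : Seminorm ℝ (Fin m → ℝ)}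
    (hφ : ∀ v, φ v = 0 → v = 0) (H : Signal p q →ₗ[ℝ] (Fin m → ℝ)) (v : Fin m → ℝ) :
    sigmaSum s (conjMap H v) + sigmaSum (2 * s) (conjMap H v) ≤ beta s φ H * φ v := by
  set P : Seminorm ℝ (Fin m → ℝ) :=
    (sigmaSeminorm s).comp (conjMap H) + (sigmaSeminorm (2 * s)).comp (conjMap H)
  change P v ≤ _
  by_cases hv : φ v = 0
  · rw [hφ v hv, map_zero, map_zero, mul_zero]
  · have hpos : 0 < φ v := lt_of_le_of_ne (apply_nonneg φ v) (Ne.symm hv)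
    have h1 : P ((φ v)⁻¹ • v) ≤ beta s φ H := by
      refine (isGreatest_beta s hφ H).2 ⟨_, ?_, rfl⟩
      rw [Set.mem_ofPred_eq, map_smul_eq_mul, Real.norm_of_nonneg (inv_nonneg.2 hpos.le),
        inv_mul_cancel₀ hv]
    rw [map_smul_eq_mul, Real.norm_of_nonneg (inv_nonneg.2 hpos.le)] at h1
    calc P v = (φ v)⁻¹ * P v * φ v := by field_simp
      _ ≤ _ := mul_le_mul_of_nonneg_right h1 hpos.le

theorem lowRankCondition_of_le {s : ℕ} {A : Signal p q →ₗ[ℝ] (Fin m → ℝ)}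
    {φ : Seminorm ℝ (Fin m → ℝ)} (hφ : ∀ v, φ v = 0 → v = 0) {γ : ℝ} {β : EReal}
    {H : Signal p q →ₗ[ℝ] (Fin m → ℝ)} (hγ : optStar s (residual A H) ≤ γ)
    (hβ : (beta s φ H : EReal) ≤ β) : LowRankCondition s A φ γ β := by
  intro z
  have h1 : sigmaSum s z + sigmaSum (2 * s) z
      ≤ beta s φ H * φ (A z) + γ * nuclearNorm z := by
    -- The decisive splitting: one part is controlled by the observation `Az`, the other by the size
    -- of `z`.
    have hz : z = conjMap H (A z) + residual A H z := by
      simp [residual]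
    have hadd : ∀ k, sigmaSum k z
        ≤ sigmaSum k (conjMap H (A z)) + sigmaSum k (residual A H z) := by
      intro k
      conv_lhs => rw [hz]
      exact map_add_le_add (sigmaSeminorm k) _ _
    have h2 := sigmaSum_add_le_beta_mul s hφ H (A z)
    have h3 := sigmaSum_add_le_opt_mul s (residual A H) z
    have h4 := mul_le_mul_of_nonneg_right ((opt_le_optStar s (residual A H)).trans hγ)
      (nuclearNorm_nonneg z)
    linarith [hadd s, hadd (2 * s)]
  -- Replacing `β[H]` by a possibly infinite `β` is legitimate because its factor `φ(Az)` is
  -- nonnegative.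
  refine (EReal.coe_le_coe_iff.2 h1).trans ?_
  rw [EReal.coe_add, EReal.coe_mul]
  gcongr

end Sets

/-! ### Positive semidefinite descriptions of the spectral and nuclear norms. -/

section SemidefiniteDescriptions

variable {ι κ : Type*} [Fintype ι] [Fintype κ]

/-- The Schur complement of the upper left identity block is `1 - MᵀM`. -/
theorem isContraction_iff_posSemidef [DecidableEq ι] [DecidableEq κ] (M : Matrix ι κ ℝ) :
    IsContraction M ↔ (Matrix.fromBlocks 1 M Mᵀ 1).PosSemidef := by
  let _ : Invertible (1 : Matrix ι ι ℝ) := invertibleOne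
  have h := Matrix.PosDef.fromBlocks₁₁ (A := (1 : Matrix ι ι ℝ)) M (1 : Matrix κ κ ℝ)
    Matrix.PosDef.one
  rw [Matrix.conjTranspose_eq_transpose_of_trivial] at h
  rw [h, inv_one, Matrix.mul_one, Matrix.posSemidef_iff_dotProduct_mulVec]
  have h1 : (1 - Mᵀ * M).IsHermitian := by
    simp [Matrix.IsHermitian, Matrix.conjTranspose_eq_transpose_of_trivial]
  have h2 : ∀ x : κ → ℝ, star x ⬝ᵥ (1 - Mᵀ * M) *ᵥ x = x ⬝ᵥ x - (M *ᵥ x) ⬝ᵥ (M *ᵥ x) := by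
    intro x
    rw [Matrix.sub_mulVec, dotProduct_sub, Matrix.one_mulVec, ← Matrix.mulVec_mulVec,
      Matrix.dotProduct_mulVec _ Mᵀ, Matrix.vecMul_transpose]
    rfl
  simp only [h1, true_and, h2, sub_nonneg]
  rfl

variable [DecidableEq κ]

/-- Write the block matrix as `∑ wᵢwᵢᵀ` and split `wᵢ = (aᵢ, bᵢ)`. Then `M = ∑ aᵢbᵢᵀ`, the traces
are `∑ |aᵢ|²` and `∑ |bᵢ|²`, and Cauchy–Schwarz bounds `∑ |aᵢ||bᵢ|`. -/
theorem nuclearNorm_le_of_posSemidef {P : Matrix ι ι ℝ} {Q : Matrix κ κ ℝ} {M : Matrix ι κ ℝ}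
    (h : (Matrix.fromBlocks P M Mᵀ Q).PosSemidef) : nuclearNorm M ≤ √P.trace * √Q.trace := by
  obtain ⟨n, w, hw⟩ := Matrix.posSemidef_iff_eq_sum_vecMulVec.1 h
  have entry : ∀ a b, Matrix.fromBlocks P M Mᵀ Q a b = ∑ i, w i a * w i b := by
    intro a b
    rw [hw]
    simp [Matrix.sum_apply, Matrix.vecMulVec_apply]
  have hM : M = ∑ i, Matrix.vecMulVec (w i ∘ Sum.inl) (w i ∘ Sum.inr) := by
    ext a b
    simpa [Matrix.sum_apply, Matrix.vecMulVec_apply] using entry (Sum.inl a) (Sum.inr b)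
  have hP : P.trace = ∑ i, (w i ∘ Sum.inl) ⬝ᵥ (w i ∘ Sum.inl) := by
    simp only [dotProduct]
    rw [Finset.sum_comm]
    exact Finset.sum_congr rfl fun a _ => by simpa using entry (Sum.inl a) (Sum.inl a)
  have hQ : Q.trace = ∑ i, (w i ∘ Sum.inr) ⬝ᵥ (w i ∘ Sum.inr) := by
    simp only [dotProduct]
    rw [Finset.sum_comm]
    exact Finset.sum_congr rfl fun a _ => by simpa using entry (Sum.inr a) (Sum.inr a)
  rw [hP, hQ, hM]
  refine (nuclearNorm_sum_le _ _).trans <|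
    (Finset.sum_le_sum fun i _ => nuclearNorm_vecMulVec_le _ _).trans ?_
  exact Real.sum_sqrt_mul_sqrt_le _ (fun _ => dotProduct_self_nonneg' _)
    (fun _ => dotProduct_self_nonneg' _)

/-- The Gram matrix of the vectors `√σᵢ (d uᵢ, d⁻¹ vᵢ)` has `M` off the diagonal; `d` shifts weight
between the two traces. Diagonal blocks of the form `Y + Yᵀ` leave the entries of `Y` free, so no
symmetry constraint on the auxiliary variables is needed. -/
theorem exists_posSemidef_of_nuclearNorm_le {M : Matrix ι κ ℝ} {d r : ℝ} (hd : 0 < d)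
    (h : nuclearNorm M ≤ r) : ∃ (Y : Matrix ι ι ℝ) (Y' : Matrix κ κ ℝ),
      (Matrix.fromBlocks (Y + Yᵀ) M Mᵀ (Y' + Y'ᵀ)).PosSemidef ∧
      2 * Y.trace ≤ d ^ 2 * r ∧ 2 * Y'.trace ≤ d⁻¹ ^ 2 * r := by
  obtain ⟨u, v, -, hu1, -, hv, -, -, hM⟩ := exists_svd M
  set σ : Fin (Fintype.card κ) → ℝ := fun i => singVal M i with hσ
  have hσ0 : ∀ i, 0 ≤ σ i := fun i => singVal_nonneg M i
  have hσr : ∑ i, σ i ≤ r := by rw [← nuclearNorm_eq]; exact h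
  refine ⟨∑ i, (σ i * d ^ 2 / 2) • Matrix.vecMulVec (u i) (u i),
    ∑ i, (σ i * d⁻¹ ^ 2 / 2) • Matrix.vecMulVec (v i) (v i), ?_, ?_, ?_⟩
  · have : ∀ x : ι ⊕ κ, ∀ y, Matrix.fromBlocks
        (∑ i, (σ i * d ^ 2 / 2) • Matrix.vecMulVec (u i) (u i)
          + (∑ i, (σ i * d ^ 2 / 2) • Matrix.vecMulVec (u i) (u i))ᵀ) M Mᵀ
        (∑ i, (σ i * d⁻¹ ^ 2 / 2) • Matrix.vecMulVec (v i) (v i)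
          + (∑ i, (σ i * d⁻¹ ^ 2 / 2) • Matrix.vecMulVec (v i) (v i))ᵀ) x y
        = (∑ i, σ i • Matrix.vecMulVec (Sum.elim (d • u i) (d⁻¹ • v i))
          (star (Sum.elim (d • u i) (d⁻¹ • v i)))) x y := by
      rintro (x | x) (y | y)
      · simp only [Matrix.fromBlocks_apply₁₁, Matrix.add_apply, Matrix.transpose_apply,
          Matrix.sum_apply, Matrix.smul_apply, Matrix.vecMulVec_apply, star_trivial, Sum.elim_inl,
          Pi.smul_apply, smul_eq_mul, ← Finset.sum_add_distrib]
        exact Finset.sum_congr rfl fun _ _ => by ring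
      · rw [hM]
        simp only [Matrix.fromBlocks_apply₁₂, Matrix.sum_apply, Matrix.smul_apply,
          Matrix.vecMulVec_apply, star_trivial, Sum.elim_inl, Sum.elim_inr,
          Pi.smul_apply, smul_eq_mul]
        exact Finset.sum_congr rfl fun _ _ => by simp only [hσ]; field_simp
      · rw [hM]
        simp only [Matrix.fromBlocks_apply₂₁, Matrix.transpose_apply, Matrix.sum_apply,
          Matrix.smul_apply, Matrix.vecMulVec_apply, star_trivial, Sum.elim_inl, Sum.elim_inr,
          Pi.smul_apply, smul_eq_mul]
        exact Finset.sum_congr rfl fun _ _ => by simp only [hσ]; field_simp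
      · simp only [Matrix.fromBlocks_apply₂₂, Matrix.add_apply, Matrix.transpose_apply,
          Matrix.sum_apply, Matrix.smul_apply, Matrix.vecMulVec_apply, star_trivial, Sum.elim_inr,
          Pi.smul_apply, smul_eq_mul, ← Finset.sum_add_distrib]
        exact Finset.sum_congr rfl fun _ _ => by ring
    rw [Matrix.ext this]
    exact Matrix.posSemidef_sum _ fun i _ =>
      (Matrix.posSemidef_vecMulVec_self_star _).smul (hσ0 i)
  · rw [Matrix.trace_sum, Finset.mul_sum]
    refine le_trans (Finset.sum_le_sum (g := fun i => d ^ 2 * σ i) fun i _ => ?_) ?_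
    · rw [Matrix.trace_smul, Matrix.trace_vecMulVec, smul_eq_mul]
      have := mul_le_mul_of_nonneg_left (hu1 i) (mul_nonneg (hσ0 i) (sq_nonneg d))
      linarith
    · rw [← Finset.mul_sum]
      exact mul_le_mul_of_nonneg_left hσr (sq_nonneg _)
  · rw [Matrix.trace_sum, Finset.mul_sum]
    refine le_trans (Finset.sum_le_sum (g := fun i => d⁻¹ ^ 2 * σ i) fun i _ => ?_) ?_
    · rw [Matrix.trace_smul, Matrix.trace_vecMulVec, smul_eq_mul, hv, if_pos rfl]
      exact le_of_eq (by ring)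
    · rw [← Finset.mul_sum]
      exact mul_le_mul_of_nonneg_left hσr (sq_nonneg _)

/-- Two separate trace bounds let the irrational radius `√k` be expressed with the integers `1` and
`k`. -/
theorem nuclearNorm_le_sqrt_mul_sqrt_iff {a b : ℝ} (ha : 0 ≤ a) (hb : 0 ≤ b)
    (M : Matrix ι κ ℝ) : nuclearNorm M ≤ √a * √b ↔
      ∃ (Y : Matrix ι ι ℝ) (Y' : Matrix κ κ ℝ),
        (Matrix.fromBlocks (Y + Yᵀ) M Mᵀ (Y' + Y'ᵀ)).PosSemidef ∧
        2 * Y.trace ≤ a ∧ 2 * Y'.trace ≤ b := by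
  constructor
  · intro h
    by_cases h0 : √a * √b = 0
    · have hM : M = 0 :=
        eq_zero_of_nuclearNorm_eq_zero (le_antisymm (h.trans_eq h0) (nuclearNorm_nonneg M))
      refine ⟨0, 0, ?_, by simpa using ha, by simpa using hb⟩
      simp [hM, Matrix.PosSemidef.zero]
    · obtain ⟨ha0, hb0⟩ := mul_ne_zero_iff.1 h0
      have ha1 : 0 < √a := lt_of_le_of_ne (Real.sqrt_nonneg _) (Ne.symm ha0)
      have hb1 : 0 < √b := lt_of_le_of_ne (Real.sqrt_nonneg _) (Ne.symm hb0)
      obtain ⟨Y, Y', hp, h1, h2⟩ :=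
        -- Chosen so that `d² √a √b = a` and `d⁻² √a √b = b`.
        exists_posSemidef_of_nuclearNorm_le (d := √(√a / √b)) (by positivity) h
      refine ⟨Y, Y', hp, h1.trans_eq ?_, h2.trans_eq ?_⟩
      · rw [Real.sq_sqrt (by positivity)]
        calc _ = √a * √a := by field_simp
          _ = a := Real.mul_self_sqrt ha
      · rw [inv_pow, Real.sq_sqrt (by positivity)]
        calc _ = √b * √b := by field_simp
          _ = b := Real.mul_self_sqrt hb
  · rintro ⟨Y, Y', hp, h1, h2⟩
    refine (nuclearNorm_le_of_posSemidef hp).trans ?_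
    refine mul_le_mul (Real.sqrt_le_sqrt ?_) (Real.sqrt_le_sqrt ?_) (Real.sqrt_nonneg _)
      (Real.sqrt_nonneg _)
    · rw [Matrix.trace_add, Matrix.trace_transpose]; linarith
    · rw [Matrix.trace_add, Matrix.trace_transpose]; linarith

end SemidefiniteDescriptions

/-! ### Closure properties of solution sets of integer linear matrix inequalities. -/

section LinearMatrixInequalities

/-- The value of the affine matrix pencil `A₀ + ∑_k x_k A_k`. -/
def pencil {I K : Type*} [Fintype K] (A₀ : Matrix I I ℤ) (A : K → Matrix I I ℤ) (x : K → ℝ) :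
    Matrix I I ℝ :=
  A₀.map (Int.cast : ℤ → ℝ) + ∑ k, x k • (A k).map (Int.cast : ℤ → ℝ)

/-- `S` is the solution set of a linear matrix inequality with rows indexed by `I`, whose
symmetric coefficient matrices have integer entries of absolute value at most `b`. -/
def IsLMISet {K : Type*} [Fintype K] (S : Set (K → ℝ)) (I : Type*) [Fintype I] (b : ℕ) : Prop :=
  ∃ (A₀ : Matrix I I ℤ) (A : K → Matrix I I ℤ),
    (A₀.IsSymm ∧ ∀ a c, |A₀ a c| ≤ b) ∧ (∀ k, (A k).IsSymm ∧ ∀ a c, |A k a c| ≤ b) ∧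
    ∀ x, x ∈ S ↔ (pencil A₀ A x).PosSemidef

theorem pencil_apply {I K : Type*} [Fintype K] (A₀ : Matrix I I ℤ) (A : K → Matrix I I ℤ)
    (x : K → ℝ) (i j : I) :
    pencil A₀ A x i j = A₀ i j + ∑ k, x k * A k i j := by
  simp [pencil, Matrix.sum_apply]

variable {K K' I I' : Type*} [Fintype K] [Fintype K'] [Fintype I] [Fintype I'] {b : ℕ}

theorem posSemidef_fromBlocks_diag_iff {P : Matrix I I ℝ} {Q : Matrix I' I' ℝ} :
    (Matrix.fromBlocks P 0 0 Q).PosSemidef ↔ P.PosSemidef ∧ Q.PosSemidef := by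
  constructor
  · intro h
    exact ⟨h.submatrix Sum.inl, h.submatrix Sum.inr⟩
  · rintro ⟨hP, hQ⟩
    refine Matrix.PosSemidef.of_dotProduct_mulVec_nonneg ?_ fun x => ?_
    · exact Matrix.IsHermitian.fromBlocks hP.1 (by simp) hQ.1
    · have h1 := hP.dotProduct_mulVec_nonneg (x ∘ Sum.inl)
      have h2 := hQ.dotProduct_mulVec_nonneg (x ∘ Sum.inr)
      have h3 : star x ⬝ᵥ (Matrix.fromBlocks P 0 0 Q) *ᵥ x
          = star (x ∘ Sum.inl) ⬝ᵥ P *ᵥ (x ∘ Sum.inl)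
            + star (x ∘ Sum.inr) ⬝ᵥ Q *ᵥ (x ∘ Sum.inr) := by
        simp [Matrix.fromBlocks_mulVec, dotProduct, Fintype.sum_sum_type]
      rw [h3]
      exact add_nonneg h1 h2

/-- Stack the two pencils block-diagonally: orders add, while the bound on the entries is unchanged.
-/
theorem IsLMISet.inter {S T : Set (K → ℝ)} (hS : IsLMISet S I b) (hT : IsLMISet T I' b) :
    IsLMISet (S ∩ T) (I ⊕ I') b := by
  obtain ⟨A₀, A, hA₀, hA, h⟩ := hS
  obtain ⟨B₀, B, hB₀, hB, h'⟩ := hT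
  have hb : ∀ {C : Matrix I I ℤ} {D : Matrix I' I' ℤ}, (C.IsSymm ∧ ∀ a c, |C a c| ≤ b) →
      (D.IsSymm ∧ ∀ a c, |D a c| ≤ b) → (Matrix.fromBlocks C 0 0 D).IsSymm ∧
        ∀ a c, |Matrix.fromBlocks C 0 0 D a c| ≤ b := by
    rintro C D ⟨hC, hC'⟩ ⟨hD, hD'⟩
    refine ⟨Matrix.IsSymm.fromBlocks hC (by simp) hD, ?_⟩
    rintro (a | a) (c | c) <;> simp [hC', hD']
  refine ⟨Matrix.fromBlocks A₀ 0 0 B₀, fun k => Matrix.fromBlocks (A k) 0 0 (B k), hb hA₀ hB₀,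
    fun k => hb (hA k) (hB k), fun x => ?_⟩
  have : pencil (Matrix.fromBlocks A₀ 0 0 B₀) (fun k => Matrix.fromBlocks (A k) 0 0 (B k)) x
      = Matrix.fromBlocks (pencil A₀ A x) 0 0 (pencil B₀ B x) := by
    ext (i | i) (j | j) <;> simp [pencil_apply]
  rw [this, posSemidef_fromBlocks_diag_iff, ← h, ← h']
  rfl

/-- Variables outside the range of `f` get the zero coefficient. Injectivity prevents coefficient
matrices from being added up, which could break the bound `b`. -/
theorem IsLMISet.comp {S : Set (K → ℝ)} (hS : IsLMISet S I b) {f : K → K'}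
    (hf : Function.Injective f) : IsLMISet {x : K' → ℝ | x ∘ f ∈ S} I b := by
  classical
  obtain ⟨A₀, A, hA₀, hA, h⟩ := hS
  refine ⟨A₀, Function.extend f A 0, hA₀, fun k' => ?_, fun x => ?_⟩
  · by_cases hk : ∃ k, f k = k'
    · obtain ⟨k, rfl⟩ := hk
      rw [hf.extend_apply]
      exact hA k
    · rw [Function.extend_apply' _ _ _ hk]
      simp [Matrix.IsSymm]
  · have : pencil A₀ (Function.extend f A 0) x = pencil A₀ A (x ∘ f) := by
      unfold pencil
      congr 1
      symm
      refine Finset.sum_of_injOn f hf.injOn (by simp) ?_ ?_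
      · intro k' _ hk'
        rw [Function.extend_apply' _ _ _ (by simpa using hk')]
        simp
      · intro k _
        rw [hf.extend_apply]
        rfl
    rw [this, ← h]
    rfl

theorem IsLMISet.reindex {S : Set (K → ℝ)} (hS : IsLMISet S I b) (e : I ≃ I') :
    IsLMISet S I' b := by
  obtain ⟨A₀, A, hA₀, hA, h⟩ := hS
  refine ⟨A₀.submatrix e.symm e.symm, fun k => (A k).submatrix e.symm e.symm,
    ⟨hA₀.1.submatrix _, fun _ _ => hA₀.2 _ _⟩,
    fun k => ⟨(hA k).1.submatrix _, fun _ _ => (hA k).2 _ _⟩, fun x => ?_⟩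
  rw [h, ← Matrix.posSemidef_submatrix_equiv e.symm]
  have : pencil (A₀.submatrix e.symm e.symm) (fun k => (A k).submatrix e.symm e.symm) x
      = (pencil A₀ A x).submatrix e.symm e.symm := by
    ext i j
    simp [pencil_apply]
  rw [this]

theorem isLMISet_linear (c : ℤ) (a : K → ℤ) (hc : |c| ≤ b) (ha : ∀ k, |a k| ≤ b) :
    IsLMISet {x : K → ℝ | 0 ≤ c + ∑ k, x k * a k} Unit b := by
  refine ⟨Matrix.diagonal fun _ => c, fun k => Matrix.diagonal fun _ => a k,
    ⟨Matrix.isSymm_diagonal _, by simpa⟩, fun k => ⟨Matrix.isSymm_diagonal _, by simpa using ha k⟩,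
    fun x => ?_⟩
  have : pencil (Matrix.diagonal fun _ : Unit => c) (fun k => Matrix.diagonal fun _ => a k) x
      = Matrix.diagonal fun _ => (c : ℝ) + ∑ k, x k * a k := by
    ext i j
    simp [pencil_apply]
  rw [this, Matrix.posSemidef_diagonal_iff]
  simp

theorem IsLMISet.isSemidefiniteRepresentable {ι κ J : Type*} [Fintype ι] [Fintype κ] [Fintype J]
    {S : Set (Matrix ι κ ℝ)} {T : Set ((ι × κ) ⊕ J → ℝ)} (hT : IsLMISet T I b) {N : ℕ}
    (hI : Fintype.card I ≤ N) (hJ : Fintype.card J ≤ N)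
    (hS : ∀ U, U ∈ S ↔ ∃ y : J → ℝ, Sum.elim (fun ij : ι × κ => U ij.1 ij.2) y ∈ T) :
    IsSemidefiniteRepresentable S N b := by
  obtain ⟨A₀, A, hA₀, hA, h⟩ := hT.reindex (Fintype.equivFin I)
  let e := Fintype.equivFin J
  refine ⟨_, Fintype.card J, A₀, fun i j => A (Sum.inl (i, j)), fun l => A (Sum.inr (e.symm l)),
    hI, hJ, hA₀, fun i j => hA _, fun l => hA _, fun U => ?_⟩
  rw [hS, ← (e.arrowCongr (Equiv.refl ℝ)).symm.exists_congr_right]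
  refine exists_congr fun y => ?_
  rw [h]
  have : pencil A₀ A (Sum.elim (fun ij : ι × κ => U ij.1 ij.2)
      ((e.arrowCongr (Equiv.refl ℝ)).symm y))
      = A₀.map (Int.cast : ℤ → ℝ)
        + ∑ i, ∑ j, U i j • (A (Sum.inl (i, j))).map (Int.cast : ℤ → ℝ)
        + ∑ l, y l • (A (Sum.inr (e.symm l))).map (Int.cast : ℤ → ℝ) := by
    rw [pencil, Fintype.sum_sum_type, Fintype.sum_prod_type, ← add_assoc]
    congr 1
    rw [← e.sum_comp]
    simp
  rw [this]

end LinearMatrixInequalities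

/-! ### Explicit integer pencils for contractions and for the nuclear norm lift. -/

section Blocks

variable {ι κ : Type*} [Fintype ι] [Fintype κ] [DecidableEq ι] [DecidableEq κ]

omit [Fintype ι] [Fintype κ] in
theorem abs_single_le {b : ℕ} (hb : 1 ≤ b) (i : ι) (j : κ) (a : ι) (c : κ) :
    |(Matrix.single i j 1 : Matrix ι κ ℤ) a c| ≤ b := by
  rw [Matrix.single_apply]
  split_ifs <;> simp [hb]

omit [Fintype ι] in
theorem abs_single_add_transpose_le {b : ℕ} (hb : 2 ≤ b) (i j a c : ι) :
    |(Matrix.single i j 1 + (Matrix.single i j 1)ᵀ : Matrix ι ι ℤ) a c| ≤ b := by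
  have h2 : 1 ≤ b := by omega
  simp only [Matrix.add_apply, Matrix.transpose_apply, Matrix.single_apply]
  split_ifs <;> simp [hb, h2]

/-- The contractions form the solution set of a linear matrix inequality. -/
theorem isLMISet_isContraction {b : ℕ} (hb : 1 ≤ b) :
    IsLMISet {x : ι × κ → ℝ | IsContraction (Matrix.of fun i j => x (i, j))} (ι ⊕ κ) b := by
  have hbz : (1 : ℤ) ≤ b := by exact_mod_cast hb
  refine ⟨1, fun ij => Matrix.fromBlocks 0 (Matrix.single ij.1 ij.2 1)
    (Matrix.single ij.1 ij.2 1)ᵀ 0, ⟨Matrix.isSymm_one, fun i j => ?_⟩, fun ij => ⟨?_, ?_⟩,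
    fun x => ?_⟩
  · rw [Matrix.one_apply]
    split_ifs
    · simpa using hb
    · simp
  · exact Matrix.IsSymm.fromBlocks Matrix.isSymm_zero rfl Matrix.isSymm_zero
  · rintro (a | a) (c | c)
    · simp
    · simp only [Matrix.fromBlocks_apply₁₂, Matrix.single_apply]
      split_ifs <;> simp [hb]
    · simp only [Matrix.fromBlocks_apply₂₁, Matrix.transpose_apply, Matrix.single_apply]
      split_ifs <;> simp [hb]
    · simp
  · rw [Set.mem_ofPred_eq, isContraction_iff_posSemidef]
    congr! 1
    ext (i | i) (j | j)
    · simp [pencil_apply, Matrix.one_apply]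
    · simp [pencil_apply, Matrix.single_apply, Fintype.sum_prod_type, ite_and]
    · simp [pencil_apply, Matrix.single_apply, Fintype.sum_prod_type, ite_and]
    · simp [pencil_apply, Matrix.one_apply]

/-- The block matrix in the semidefinite description of the nuclear norm, as a function of the
entries of the given matrix and of the two auxiliary ones. -/
def nuclearBlock (x : (ι × κ) ⊕ ((ι × ι) ⊕ (κ × κ)) → ℝ) : Matrix (ι ⊕ κ) (ι ⊕ κ) ℝ :=
  Matrix.fromBlocks
    ((Matrix.of fun i j => x (Sum.inr (Sum.inl (i, j))))
      + (Matrix.of fun i j => x (Sum.inr (Sum.inl (i, j))))ᵀ)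
    (Matrix.of fun i j => x (Sum.inl (i, j)))
    (Matrix.of fun i j => x (Sum.inl (i, j)))ᵀ
    ((Matrix.of fun i j => x (Sum.inr (Sum.inr (i, j))))
      + (Matrix.of fun i j => x (Sum.inr (Sum.inr (i, j))))ᵀ)

/-- The lift of the nuclear norm ball of radius `√(a a')`. -/
def nuclearLift (ι κ : Type*) [Fintype ι] [Fintype κ] (a a' : ℕ) :
    Set ((ι × κ) ⊕ ((ι × ι) ⊕ (κ × κ)) → ℝ) :=
  {x | (nuclearBlock x).PosSemidef} ∩
    ({x | 2 * ∑ i, x (Sum.inr (Sum.inl (i, i))) ≤ a} ∩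
      {x | 2 * ∑ j, x (Sum.inr (Sum.inr (j, j))) ≤ a'})

omit [DecidableEq ι] in
theorem nuclearNorm_le_iff_exists_mem_nuclearLift (a a' : ℕ) (M : Matrix ι κ ℝ) :
    nuclearNorm M ≤ √a * √a' ↔ ∃ y : (ι × ι) ⊕ (κ × κ) → ℝ,
      Sum.elim (fun ij : ι × κ => M ij.1 ij.2) y ∈ nuclearLift ι κ a a' := by
  rw [nuclearNorm_le_sqrt_mul_sqrt_iff (Nat.cast_nonneg a) (Nat.cast_nonneg a')]
  constructor
  · rintro ⟨Y, Y', h⟩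
    exact ⟨Sum.elim (fun ij => Y ij.1 ij.2) (fun ij => Y' ij.1 ij.2), h⟩
  · rintro ⟨y, h⟩
    exact ⟨Matrix.of fun i j => y (Sum.inl (i, j)), Matrix.of fun i j => y (Sum.inr (i, j)), h⟩

theorem isLMISet_posSemidef_nuclearBlock {b : ℕ} (hb : 2 ≤ b) :
    IsLMISet {x : (ι × κ) ⊕ ((ι × ι) ⊕ (κ × κ)) → ℝ | (nuclearBlock x).PosSemidef} (ι ⊕ κ) b := by
  have hb1 : 1 ≤ b := by omega
  refine ⟨0, Sum.elim (fun ij => Matrix.fromBlocks 0 (Matrix.single ij.1 ij.2 1)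
    (Matrix.single ij.1 ij.2 1)ᵀ 0) (Sum.elim
      (fun ij => Matrix.fromBlocks
        (Matrix.single ij.1 ij.2 1 + (Matrix.single ij.1 ij.2 1)ᵀ) 0 0 0)
      (fun ij => Matrix.fromBlocks 0 0 0
        (Matrix.single ij.1 ij.2 1 + (Matrix.single ij.1 ij.2 1)ᵀ))),
    ⟨Matrix.isSymm_zero, by simp⟩, ?_, fun x => ?_⟩
  · have h0 : (0 : ℤ) ≤ b := by positivity
    rintro (⟨i, j⟩ | ⟨i, j⟩ | ⟨i, j⟩)
    · refine ⟨Matrix.IsSymm.fromBlocks Matrix.isSymm_zero rfl Matrix.isSymm_zero, ?_⟩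
      rintro (a | a) (c | c)
      · simp
      · exact abs_single_le hb1 i j a c
      · exact abs_single_le hb1 i j c a
      · simp
    · refine ⟨Matrix.IsSymm.fromBlocks (Matrix.isSymm_add_transpose_self _) (by simp)
        Matrix.isSymm_zero, ?_⟩
      rintro (a | a) (c | c)
      · exact abs_single_add_transpose_le hb i j a c
      all_goals simp
    · refine ⟨Matrix.IsSymm.fromBlocks Matrix.isSymm_zero (by simp)
        (Matrix.isSymm_add_transpose_self _), ?_⟩
      rintro (a | a) (c | c)
      case inr.inr => exact abs_single_add_transpose_le hb i j a c
      all_goals simp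
  · rw [Set.mem_ofPred_eq, nuclearBlock]
    congr! 1
    ext (i | i) (j | j)
    · simp [pencil_apply, Matrix.single_apply, Fintype.sum_prod_type, ite_and, mul_add,
        Finset.sum_add_distrib]
    · simp [pencil_apply, Matrix.single_apply, Fintype.sum_prod_type, ite_and]
    · simp [pencil_apply, Matrix.single_apply, Fintype.sum_prod_type, ite_and]
    · simp [pencil_apply, Matrix.single_apply, Fintype.sum_prod_type, ite_and, mul_add,
        Finset.sum_add_distrib]

theorem isLMISet_nuclearLift {a a' b : ℕ} (hb : 2 ≤ b) (ha : a ≤ b) (ha' : a' ≤ b) :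
    IsLMISet (nuclearLift ι κ a a') ((ι ⊕ κ) ⊕ (Unit ⊕ Unit)) b := by
  -- Each trace bound is the scalar inequality `0 ≤ a - 2 ∑ yᵢᵢ`, with coefficient `-2` on the
  -- diagonal variables.
  have hite : ∀ P : Prop, ∀ [Decidable P], |if P then (-2 : ℤ) else 0| ≤ b := by
    intro P _
    split_ifs <;> simp [hb]
  refine (isLMISet_posSemidef_nuclearBlock hb).inter (IsLMISet.inter ?_ ?_)
  · convert isLMISet_linear (a : ℤ) (Sum.elim (fun _ : ι × κ => 0) (Sum.elim
      (fun ij : ι × ι => if ij.1 = ij.2 then -2 else 0) (fun _ : κ × κ => 0)))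
      (by simpa using ha) ?_ using 2
    · ext x
      simp [Fintype.sum_prod_type, Finset.mul_sum, mul_comm]
    · rintro (_ | ij | _)
      · simp
      · exact hite _
      · simp
  · convert isLMISet_linear (a' : ℤ) (Sum.elim (fun _ : ι × κ => 0) (Sum.elim
      (fun _ : ι × ι => 0) (fun ij : κ × κ => if ij.1 = ij.2 then -2 else 0)))
      (by simpa using ha') ?_ using 2
    · ext x
      simp [Fintype.sum_prod_type, Finset.mul_sum, mul_comm]
    · rintro (_ | _ | ij)
      · simp
      · simp
      · exact hite _

end Blocks

/-! ### Assembling the linear matrix inequality for `Z*_k`. -/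

section RefinedSet

variable {p q : ℕ}

theorem elim_comp_map_mem_iff {α β α' β' γ : Type*} (S : Set (α ⊕ β → γ)) (g : α' → γ)
    (y : β' → γ) (f : α → α') (h : β → β') :
    Sum.elim g y ∘ Sum.map f h ∈ S ↔ Sum.elim (g ∘ f) (y ∘ h) ∈ S := by
  rw [Sum.elim_comp_map]

/-- Five blocks are stacked: three nuclear norm lifts, each with its own auxiliary variables (`J`,
`J₁`, `J₂`), and two contraction blocks without any. Coefficients never exceed the larger of `2` and
`k`. -/
theorem isSemidefiniteRepresentable_setZstar (k : ℕ) :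
    IsSemidefiniteRepresentable (setZstar p q k) (10 * (p + q + 1) ^ 4) (2 * k + 2) := by
  -- `e₁` and `e₂` locate the entries of `rearr1 U` and `rearr2 U` inside `U`, so a constraint on a
  -- rearrangement is a constraint on `U` with renamed variables.
  let e₁ : (Fin p × Fin p) × (Fin q × Fin q) → (Fin q × Fin p) × (Fin p × Fin q) :=
    fun c => ((c.2.1, c.1.2), (c.1.1, c.2.2))
  let e₂ : (Fin p × Fin q) × (Fin q × Fin p) → (Fin q × Fin p) × (Fin p × Fin q) :=
    fun c => ((c.1.2, c.2.2), (c.1.1, c.2.1))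
  have he₁ : Function.Injective e₁ := by
    rintro ⟨⟨_, _⟩, ⟨_, _⟩⟩ ⟨⟨_, _⟩, ⟨_, _⟩⟩ h
    simp only [e₁, Prod.mk.injEq] at h ⊢
    tauto
  have he₂ : Function.Injective e₂ := by
    rintro ⟨⟨_, _⟩, ⟨_, _⟩⟩ ⟨⟨_, _⟩, ⟨_, _⟩⟩ h
    simp only [e₂, Prod.mk.injEq] at h ⊢
    tauto
  have hN : IsLMISet _ _ (2 * k + 2) :=
    isLMISet_nuclearLift (ι := Fin q × Fin p) (κ := Fin p × Fin q) (a := k) (a' := k)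
      (by omega) (by omega) (by omega)
  have hN₁ : IsLMISet _ _ (2 * k + 2) :=
    isLMISet_nuclearLift (ι := Fin p × Fin p) (κ := Fin q × Fin q) (a := k) (a' := k)
      (by omega) (by omega) (by omega)
  have hN₂ : IsLMISet _ _ (2 * k + 2) :=
    isLMISet_nuclearLift (ι := Fin p × Fin q) (κ := Fin q × Fin p) (a := 1) (a' := k)
      (by omega) (by omega) (by omega)
  have hC : IsLMISet _ _ (2 * k + 2) :=
    isLMISet_isContraction (ι := Fin q × Fin p) (κ := Fin p × Fin q) (by omega)
  have hC₁ : IsLMISet _ _ (2 * k + 2) :=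
    isLMISet_isContraction (ι := Fin p × Fin p) (κ := Fin q × Fin q) (by omega)
  let J := (Fin q × Fin p) × (Fin q × Fin p) ⊕ (Fin p × Fin q) × (Fin p × Fin q)
  let J₁ := (Fin p × Fin p) × (Fin p × Fin p) ⊕ (Fin q × Fin q) × (Fin q × Fin q)
  let J₂ := (Fin p × Fin q) × (Fin p × Fin q) ⊕ (Fin q × Fin p) × (Fin q × Fin p)
  have hT := (hN.comp (f := Sum.map id (Sum.inl : J → J ⊕ (J₁ ⊕ J₂)))
      (Function.injective_id.sumMap Sum.inl_injective)).inter <|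
    (hN₁.comp (f := Sum.map e₁ ((Sum.inr : J₁ ⊕ J₂ → J ⊕ (J₁ ⊕ J₂)) ∘ Sum.inl))
      (he₁.sumMap (Sum.inr_injective.comp Sum.inl_injective))).inter <|
    (hN₂.comp (f := Sum.map e₂ ((Sum.inr : J₁ ⊕ J₂ → J ⊕ (J₁ ⊕ J₂)) ∘ Sum.inr))
      (he₂.sumMap (Sum.inr_injective.comp Sum.inr_injective))).inter <|
    (hC.comp (f := Sum.inl) Sum.inl_injective).inter
      (hC₁.comp (f := Sum.inl ∘ e₁) (Sum.inl_injective.comp he₁))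
  -- With `n = p + q`: the order is `2p² + 2q² + 6pq + 6 ≤ 3n² + 6`, and the number of auxiliary
  -- variables is `p⁴ + q⁴ + 4p²q² ≤ n⁴`.
  have hpow : ∀ n : ℕ, n ^ 4 ≤ 10 * (n + 1) ^ 4 ∧ 3 * n ^ 2 + 6 ≤ 10 * (n + 1) ^ 4 := by
    intro n
    constructor <;> ring_nf <;> nlinarith [Nat.zero_le n]
  have hsq : √(k : ℝ) * √(k : ℝ) = k := Real.mul_self_sqrt (Nat.cast_nonneg k)
  have h1k : √((1 : ℕ) : ℝ) * √(k : ℝ) = √(k : ℝ) := by simp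
  refine hT.isSemidefiniteRepresentable ?_ ?_ fun U => ?_
  · refine le_trans ?_ (hpow (p + q)).2
    simp only [Fintype.card_sum, Fintype.card_prod, Fintype.card_fin, Fintype.card_unit]
    nlinarith [sq_nonneg p]
  · refine le_trans ?_ (hpow (p + q)).1
    simp only [J, J₁, J₂, Fintype.card_sum, Fintype.card_prod, Fintype.card_fin]
    ring_nf
    nlinarith [Nat.zero_le (p ^ 3 * q), Nat.zero_le (p * q ^ 3), Nat.zero_le (p ^ 2 * q ^ 2)]
  · have h0 := nuclearNorm_le_iff_exists_mem_nuclearLift k k U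
    have h1 := nuclearNorm_le_iff_exists_mem_nuclearLift k k (rearr1 U)
    have h2 := nuclearNorm_le_iff_exists_mem_nuclearLift 1 k (rearr2 U)
    rw [hsq] at h0 h1
    rw [h1k] at h2
    have hU : U ∈ setZstar p q k ↔ nuclearNorm U ≤ k ∧ nuclearNorm (rearr1 U) ≤ k ∧
        nuclearNorm (rearr2 U) ≤ √(k : ℝ) ∧ IsContraction U ∧ IsContraction (rearr1 U) := by
      rw [isContraction_iff_spectralNorm_le_one, isContraction_iff_spectralNorm_le_one]
      change _ ∧ _ ↔ _
      tauto
    rw [hU, h0, h1, h2]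
    constructor
    · rintro ⟨⟨y, hy⟩, ⟨y₁, hy₁⟩, ⟨y₂, hy₂⟩, hc, hc₁⟩
      refine ⟨Sum.elim y (Sum.elim y₁ y₂), ?_, ?_, ?_, hc, hc₁⟩
      · exact (elim_comp_map_mem_iff _ _ _ _ _).2 hy
      · exact (elim_comp_map_mem_iff _ _ _ _ _).2 hy₁
      · exact (elim_comp_map_mem_iff _ _ _ _ _).2 hy₂
    · rintro ⟨y, hy, hy₁, hy₂, hc, hc₁⟩
      exact ⟨⟨_, (elim_comp_map_mem_iff _ _ _ _ _).1 hy⟩,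
        ⟨_, (elim_comp_map_mem_iff _ _ _ _ _).1 hy₁⟩,
        ⟨_, (elim_comp_map_mem_iff _ _ _ _ _).1 hy₂⟩, hc, hc₁⟩

end RefinedSet

end NuclearRecovery

open NuclearRecovery in
theorem proposition7 (p q m s : ℕ) (hqp : q ≤ p)
    (A : Signal p q →ₗ[ℝ] (Fin m → ℝ))
    (φ : Seminorm ℝ (Fin m → ℝ)) (hφ : ∀ v, φ v = 0 → v = 0)
    (betaHat : (Signal p q →ₗ[ℝ] (Fin m → ℝ)) → ℝ)
    (hconv : ConvexOn ℝ Set.univ betaHat)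
    (hbound : ∀ H, beta s φ H ≤ betaHat H) :
    -- the refined sets
    (∀ k : ℕ, setZ p q k ⊆ setZstar p q k ∧ setZstar p q k ⊆ setU p q k ∧
      Convex ℝ (setZstar p q k) ∧
      IsSemidefiniteRepresentable (setZstar p q k) (10 * (p + q + 1) ^ 4) (2 * k + 2)) ∧
    -- the maxima in question are attained
    (∀ W : Signal p q →ₗ[ℝ] Signal p q,
      IsGreatest (optValues s W) (opt s W) ∧
      IsGreatest (relaxValues (setZstar p q s) (setZstar p q (2 * s)) W) (optStar s W) ∧
      IsGreatest (relaxValues (setU p q s) (setU p q (2 * s)) W) (optBar s W)) ∧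
    (∀ H : Signal p q →ₗ[ℝ] (Fin m → ℝ), IsGreatest (betaValues s φ H) (beta s φ H)) ∧
    -- the refined bound
    (∀ W : Signal p q →ₗ[ℝ] Signal p q, opt s W ≤ optStar s W ∧ optStar s W ≤ optBar s W) ∧
    ConvexOn ℝ Set.univ (fun W : Signal p q →ₗ[ℝ] Signal p q => optStar s W) ∧
    ConvexOn ℝ Set.univ
      (fun H : Signal p q →ₗ[ℝ] (Fin m → ℝ) => optStar s (residual A H)) ∧
    -- the system of convex constraints and its sufficiency
    ∀ (γ : ℝ) (β : EReal), 0 ≤ γ → 0 ≤ β →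
      Convex ℝ {H : Signal p q →ₗ[ℝ] (Fin m → ℝ) |
        optStar s (residual A H) ≤ γ ∧ (betaHat H : EReal) ≤ β} ∧
      ((∃ H : Signal p q →ₗ[ℝ] (Fin m → ℝ),
          optStar s (residual A H) ≤ γ ∧ (betaHat H : EReal) ≤ β) →
        LowRankCondition s A φ γ β) := by
  exact ⟨fun k => ⟨setZ_subset_setZstar k, setZstar_subset_setU k, convex_setZstar k,
      isSemidefiniteRepresentable_setZstar k⟩,
    fun W => ⟨isGreatest_opt s W, isGreatest_optStar s W, isGreatest_optBar s W⟩,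
    fun H => isGreatest_beta s hφ H,
    fun W => ⟨opt_le_optStar s W, optStar_le_optBar s W⟩,
    convexOn_optStar s, convexOn_optStar_residual s A,
    fun γ β _ _ => ⟨convex_system s A hconv γ β, fun ⟨H, hγ, hβ⟩ =>
      lowRankCondition_of_le hφ hγ ((EReal.coe_le_coe_iff.2 (hbound H)).trans hβ)⟩⟩
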